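/- Let $n\in\{1,2,\dots,\infty\}$ and let $\mathcal{TO}_n$ be the unital $C^*$-algebra which is universal for collections of $n$ isometries with mutually orthogonal ranges, with distinguished generating isometries $\{v_i : 1\le i\le n\}$ (so $\mathcal{TO}_\infty=\mathcal O_\infty$ is the Cuntz algebra). Let $\mathcal E\subseteq\mathcal{TO}_n$ be the closed linear span of the $v_i$, a Hilbert space under the inner product, linear in the first variable, given by $g^*f=\langle f,g\rangle 1$. Let $\mathcal F_n$ be the fixed-point algebra of the gauge action $\gamma$ of the circle $\mathbb T$ on $\mathcal{TO}_n$, where $\gamma_z(v_i)=zv_i$. Let $(e_k)_{k\ge1}$ be a sequence of unit vectors in $\mathcal E$ with finite period $p\ge1$, i.e. $p$ is the smallest positive integer for which $\sum_{i=1}^\infty\bigl(1-|\langle e_i,e_{i+p}\rangle|\bigr)$ converges, and suppose that $\langle e_i,e_{i+p}\rangle$ is real and nonnegative for every $i$. There is a unique state $\rho$ of $\mathcal F_n$ (the corresponding product state) such that, for all $m\ge0$ and all indices, $$\rho(v_{i_1}\cdots v_{i_m}v_{j_m}^*\cdots v_{j_1}^*)=\langle v_{i_1},e_1\rangle\cdots\langle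 v_{i_m},e_m\rangle\langle e_m,v_{j_m}\rangle\cdots\langle e_1,v_{j_1}\rangle ,$$ and $\rho$ is pure. **Theorem.** There is an affine bijection $\sigma\mapsto\rho_\sigma$ from the set $P(\mathbb T)$ of Borel probability measures on $\mathbb T$ onto the set of all states of $\mathcal{TO}_n$ which extend $\rho$, given, for all $k,l\ge0$ and all indices, by $$\rho_\sigma(v_{i_1}\cdots v_{i_k}v_{j_l}^*\cdots v_{j_1}^*)=\lambda_{k,l}\,\langle v_{i_1},e_1\rangle\cdots\langle v_{i_k},e_k\rangle\,\langle e_l,v_{j_l}\rangle\cdots\langle e_1,v_{j_1}\rangle ,$$ where $$\lambda_{k,l}=\begin{cases}\hat\sigma\!\left(\frac{k-l}{p}\right)\prod_{i=1}^\infty\langle e_{l+i},e_{k+i}\rangle & \text{if } k-l\in p\mathbb Z,\\ 0 & \text{otherwise,}\end{cases}$$ $\hat\sigma(m)=\int_{\mathbb T}z^{-m}\,d\sigma(z)$ is the Fourier transform of $\sigma$, and the infinite products that occur converge (unconditionally) whenever $k-l\in p\mathbb Z$. -/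

import Mathlib

open MeasureTheory
open scoped ComplexOrder

universe u

namespace ToeplitzCuntz

/-- A family of isometries with mutually orthogonal ranges in a unital C⋆-algebra. -/
structure IsIsometryFamily {ι B : Type u} [CStarAlgebra B] (w : ι → B) : Prop where
  isometry : ∀ i, star (w i) * w i = 1
  orthogonal : ∀ i j, i ≠ j → star (w j) * w i = 0

/-- `A`, with distinguished generators `v i`, is the Toeplitz-Cuntz algebra on the index set `ι`:
the unital C⋆-algebra which is universal for families, indexed by `ι`, of isometries with mutually
orthogonal ranges.  See `exists_isToeplitzCuntz` for its existence. -/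
structure IsToeplitzCuntz {ι A : Type u} [CStarAlgebra A] (v : ι → A) : Prop where
  family : IsIsometryFamily v
  generates : (StarAlgebra.adjoin ℂ (Set.range v)).topologicalClosure = ⊤
  universal : ∀ (B : Type u) [CStarAlgebra B] (w : ι → B), IsIsometryFamily w →
    ∃ φ : A →⋆ₐ[ℂ] B, ∀ i, φ (v i) = w i

section Existence

/-- Evaluation of noncommutative polynomials at a family and its adjoints. -/
noncomputable def polyEval {ι B : Type u} [CStarAlgebra B] (w : ι → B) :
    FreeAlgebra ℂ (ι ⊕ ι) →ₐ[ℂ] B :=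
  FreeAlgebra.lift ℂ (Sum.elim w (fun i => star (w i)))

lemma mem_adjoin_iff {ι B : Type u} [CStarAlgebra B] (w : ι → B) (b : B) :
    b ∈ StarAlgebra.adjoin ℂ (Set.range w) ↔ ∃ x, polyEval w x = b := by
  have h1 : Set.range w ∪ star (Set.range w) =
      Set.range (Sum.elim w (fun i => star (w i))) := by
    rw [Set.Sum.elim_range]
    congr 1
    ext x
    simp only [Set.mem_star, Set.mem_range]
    exact exists_congr fun y => ⟨fun h => by rw [h, star_star], fun h => by rw [← h, star_star]⟩
  rw [← StarSubalgebra.mem_toSubalgebra, StarAlgebra.adjoin_toSubalgebra, h1,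
    Algebra.adjoin_range_eq_range_freeAlgebra_lift]
  exact AlgHom.mem_range _

lemma IsIsometryFamily.norm_le {ι B : Type u} [CStarAlgebra B] {w : ι → B}
    (hw : IsIsometryFamily w) (i : ι) : ‖w i‖ ≤ 1 := by
  have h := CStarRing.norm_star_mul_self (x := w i)
  rw [hw.isometry i] at h
  rcases subsingleton_or_nontrivial B with hB | hB
  · rw [Subsingleton.elim (w i) 0]; simp
  · rw [CStarRing.norm_one] at h
    nlinarith [norm_nonneg (w i)]

/-- The norms on noncommutative polynomials that arise from families of isometries with mutually
orthogonal ranges in nontrivial C⋆-algebras. -/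
def NormIndex (ι : Type u) : Type u :=
  {N : FreeAlgebra ℂ (ι ⊕ ι) → ℝ // ∃ (B : Type u) (_ : CStarAlgebra B) (_ : Nontrivial B)
    (w : ι → B), IsIsometryFamily w ∧ ∀ x, N x = ‖polyEval w x‖}

/-- The Toeplitz-Cuntz algebra exists, for every index set. -/
theorem exists_isToeplitzCuntz (ι : Type u) :
    ∃ (A : Type u) (_ : CStarAlgebra A) (v : ι → A), IsToeplitzCuntz v := by
  classical
  choose B iB nB w hw hN using fun N : NormIndex ι => N.2
  let iP : CStarAlgebra (lp B ⊤) := { }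
  have hmem : ∀ i, Memℓp (fun N => w N i) ⊤ := fun i =>
    memℓp_infty ⟨1, by rintro _ ⟨N, rfl⟩; exact (hw N).norm_le i⟩
  let g : ι → lp B ⊤ := fun i => ⟨fun N => w N i, hmem i⟩
  have hg : IsIsometryFamily g := by
    constructor
    · intro i
      ext N
      simpa [g] using (hw N).isometry i
    · intro i j hij
      ext N
      simpa [g] using (hw N).orthogonal i j hij
  let S : StarSubalgebra ℂ (lp B ⊤) := (StarAlgebra.adjoin ℂ (Set.range g)).topologicalClosure
  have hS : IsClosed (S : Set (lp B ⊤)) := StarSubalgebra.isClosed_topologicalClosure _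
  have hgS : ∀ i, g i ∈ S := fun i =>
    StarSubalgebra.le_topologicalClosure _ (StarAlgebra.subset_adjoin ℂ _ ⟨i, rfl⟩)
  refine ⟨S, inferInstance, fun i => ⟨g i, hgS i⟩, ⟨?_, ?_⟩, ?_, ?_⟩
  · intro i; exact Subtype.ext (hg.isometry i)
  · intro i j hij; exact Subtype.ext (hg.orthogonal i j hij)
  · rw [eq_top_iff]
    rintro ⟨a, ha⟩ -
    let v : ι → S := fun i => ⟨g i, hgS i⟩
    change (⟨a, ha⟩ : S) ∈ closure (StarAlgebra.adjoin ℂ (Set.range v) : Set S)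
    rw [closure_subtype]
    have ha' : a ∈ closure (StarAlgebra.adjoin ℂ (Set.range g) : Set (lp B ⊤)) := ha
    refine closure_mono ?_ ha'
    have h1 : StarAlgebra.adjoin ℂ (Set.range g) ≤
        (StarAlgebra.adjoin ℂ (Set.range v)).map S.subtype := by
      refine StarAlgebra.adjoin_le ?_
      rintro _ ⟨i, rfl⟩
      exact ⟨v i, StarAlgebra.subset_adjoin ℂ _ ⟨i, rfl⟩, rfl⟩
    exact h1
  · intro C iC c hc
    rcases subsingleton_or_nontrivial C with hC | hC
    · exact ⟨{ toFun := fun _ => 0, map_one' := Subsingleton.elim _ _,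
               map_mul' := fun _ _ => Subsingleton.elim _ _,
               map_zero' := rfl, map_add' := fun _ _ => Subsingleton.elim _ _,
               commutes' := fun _ => Subsingleton.elim _ _,
               map_star' := fun _ => Subsingleton.elim _ _ }, fun _ => Subsingleton.elim _ _⟩
    -- the closed subalgebra generated by the graph projects isometrically onto `S`
    let N₀ : NormIndex ι := ⟨fun x => ‖polyEval c x‖, C, iC, hC, c, hc, fun _ => rfl⟩
    let d : ι → lp B ⊤ × C := fun i => (g i, c i)
    let D : StarSubalgebra ℂ (lp B ⊤ × C) :=
      (StarAlgebra.adjoin ℂ (Set.range d)).topologicalClosure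
    have hD : IsClosed (D : Set (lp B ⊤ × C)) := StarSubalgebra.isClosed_topologicalClosure _
    have hdD : ∀ i, d i ∈ D := fun i =>
      StarSubalgebra.le_topologicalClosure _ (StarAlgebra.subset_adjoin ℂ _ ⟨i, rfl⟩)
    let ev : lp B ⊤ →ₐ[ℂ] B N₀ :=
      { toFun := fun f => f N₀, map_one' := rfl, map_mul' := fun _ _ => rfl, map_zero' := rfl,
        map_add' := fun _ _ => rfl, commutes' := fun _ => rfl }
    have hnorm : ∀ y ∈ D, ‖y.2‖ ≤ ‖y.1‖ := by
      have hcl : IsClosed {y : lp B ⊤ × C | ‖y.2‖ ≤ ‖y.1‖} :=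
        isClosed_le (by fun_prop) (by fun_prop)
      have hsub : (StarAlgebra.adjoin ℂ (Set.range d) : Set (lp B ⊤ × C)) ⊆
          {y : lp B ⊤ × C | ‖y.2‖ ≤ ‖y.1‖} := by
        intro y hy
        obtain ⟨x, rfl⟩ := (mem_adjoin_iff d y).1 hy
        have e1 : ev ((polyEval d x).1) = polyEval (w N₀) x := by
          have : (ev.comp (AlgHom.fst ℂ (lp B ⊤) C)).comp (polyEval d) = polyEval (w N₀) := by
            apply FreeAlgebra.hom_ext
            funext i
            rcases i with i | i
            · simp only [polyEval, Function.comp_apply, AlgHom.comp_apply,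
                FreeAlgebra.lift_ι_apply, Sum.elim_inl]
              rfl
            · simp only [polyEval, Function.comp_apply, AlgHom.comp_apply,
                FreeAlgebra.lift_ι_apply, Sum.elim_inr]
              rfl
          exact DFunLike.congr_fun this x
        have e2 : (polyEval d x).2 = polyEval c x := by
          have : (AlgHom.snd ℂ (lp B ⊤) C).comp (polyEval d) = polyEval c := by
            apply FreeAlgebra.hom_ext
            funext i
            rcases i with i | i <;> simp [polyEval, d]
          exact DFunLike.congr_fun this x
        have e3 : ‖polyEval c x‖ = ‖polyEval (w N₀) x‖ := hN N₀ x
        change ‖(polyEval d x).2‖ ≤ ‖(polyEval d x).1‖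
        rw [e2, e3, ← e1]
        exact lp.norm_apply_le_norm ENNReal.top_ne_zero (polyEval d x).1 N₀
      intro y hy
      exact closure_minimal hsub hcl hy
    let f : D →⋆ₐ[ℂ] lp B ⊤ := (StarAlgHom.fst ℂ (lp B ⊤) C).comp D.subtype
    have hf : Isometry f := by
      refine AddMonoidHomClass.isometry_of_norm f ?_
      rintro ⟨y, hy⟩
      change ‖y.1‖ = ‖y‖
      rw [Prod.norm_def, max_eq_left (hnorm y hy)]
    have hrange : ∀ a : S, ∃ y : D, f y = a := by
      have hDc : CompleteSpace D := hD.completeSpace_coe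
      have hfc : IsClosed (f.range : Set (lp B ⊤)) := by
        have h := hf.isClosedEmbedding.isClosed_range
        exact h
      have hle : S ≤ f.range := by
        refine StarSubalgebra.topologicalClosure_minimal (StarAlgebra.adjoin_le ?_) hfc
        rintro _ ⟨i, rfl⟩
        exact ⟨⟨d i, hdD i⟩, rfl⟩
      intro a
      exact hle a.2
    choose s hs using hrange
    have hinj := hf.injective
    let t : D →⋆ₐ[ℂ] C := (StarAlgHom.snd ℂ (lp B ⊤) C).comp D.subtype
    have s1 : s 1 = 1 := hinj (by rw [hs, map_one]; rfl)
    have s0 : s 0 = 0 := hinj (by rw [hs, map_zero]; rfl)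
    have sm : ∀ a b, s (a * b) = s a * s b := fun a b =>
      hinj (by rw [hs, map_mul, hs, hs]; rfl)
    have sa : ∀ a b, s (a + b) = s a + s b := fun a b =>
      hinj (by rw [hs, map_add, hs, hs]; rfl)
    have sc : ∀ r : ℂ, s (algebraMap ℂ S r) = algebraMap ℂ D r := fun r =>
      hinj (by rw [hs, AlgHomClass.commutes]; rfl)
    have ss : ∀ a, s (star a) = star (s a) := fun a =>
      hinj (by rw [hs, map_star, hs]; rfl)
    refine ⟨{ toFun := fun a => t (s a), map_one' := by rw [s1, map_one],
              map_mul' := fun a b => by rw [sm, map_mul],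
              map_zero' := by rw [s0, map_zero], map_add' := fun a b => by rw [sa, map_add],
              commutes' := fun r => by rw [sc, AlgHomClass.commutes],
              map_star' := fun a => by rw [ss, map_star] }, fun i => ?_⟩
    have : s ⟨g i, hgS i⟩ = ⟨d i, hdD i⟩ := hinj (by rw [hs]; rfl)
    change t (s ⟨g i, hgS i⟩) = c i
    rw [this]
    rfl

end Existence

/-- The closed linear span `E` of the generators. -/
noncomputable def fiber {ι A : Type u} [CStarAlgebra A] (v : ι → A) : Submodule ℂ A :=
  (Submodule.span ℂ (Set.range v)).topologicalClosure

open Classical in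
/-- The inner product `⟨f, g⟩`, linear in the first variable, determined by `g⋆ f = ⟨f, g⟩ 1`
(see `star_mul_eq_ip` for its validity on `E`). -/
noncomputable def ip {A : Type u} [CStarAlgebra A] (f g : A) : ℂ :=
  if h : ∃ c : ℂ, star g * f = c • (1 : A) then h.choose else 0

lemma star_mul_eq_ip {ι A : Type u} [CStarAlgebra A] {v : ι → A} (hv : IsIsometryFamily v)
    {f g : A} (hf : f ∈ fiber v) (hg : g ∈ fiber v) : star g * f = ip f g • (1 : A) := by
  let L : Submodule ℂ A := Submodule.span ℂ {1}
  have hL : IsClosed (L : Set A) := L.closed_of_finiteDimensional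
  have key : star g * f ∈ L := by
    have h1 : ∀ i, ∀ x ∈ fiber v, star (v i) * x ∈ L := by
      intro i x hx
      have hcl : IsClosed {x : A | star (v i) * x ∈ L} := hL.preimage (by fun_prop)
      refine closure_minimal ?_ hcl hx
      intro y hy
      induction hy using Submodule.span_induction with
      | mem y hy =>
        obtain ⟨j, rfl⟩ := hy
        change _ ∈ L
        by_cases hij : j = i
        · subst hij
          rw [hv.isometry]
          exact Submodule.mem_span_singleton_self 1
        · rw [hv.orthogonal j i hij]
          exact L.zero_mem
      | zero => simp
      | add a b _ _ ha hb =>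
        change _ ∈ L
        rw [mul_add]
        exact L.add_mem ha hb
      | smul c a _ ha =>
        change _ ∈ L
        rw [mul_smul_comm]
        exact L.smul_mem c ha
    have hcl : IsClosed {y : A | star y * f ∈ L} :=
      hL.preimage ((continuous_star).mul continuous_const)
    refine closure_minimal ?_ hcl hg
    intro y hy
    induction hy using Submodule.span_induction with
    | mem y hy =>
      obtain ⟨j, rfl⟩ := hy
      exact h1 j f hf
    | zero => simp
    | add a b _ _ ha hb =>
      change _ ∈ L
      rw [star_add, add_mul]
      exact L.add_mem ha hb
    | smul c a _ ha =>
      change _ ∈ L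
      rw [star_smul, smul_mul_assoc]
      exact L.smul_mem _ ha
  obtain ⟨c, hc⟩ := Submodule.mem_span_singleton.1 key
  have h : ∃ c : ℂ, star g * f = c • (1 : A) := ⟨c, hc.symm⟩
  rw [ip, dif_pos h]
  exact h.choose_spec

/-- The monomial `v_{i_1} ⋯ v_{i_k}`. -/
noncomputable def word {ι A : Type u} [CStarAlgebra A] (v : ι → A) {k : ℕ} (μ : Fin k → ι) : A :=
  (List.ofFn fun a => v (μ a)).prod

/-- The states of a unital C⋆-algebra, as a subset of its dual. -/
def stateSpace (A : Type u) [CStarAlgebra A] : Set (StrongDual ℂ A) :=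
  {φ | (∀ a, 0 ≤ φ (star a * a)) ∧ φ 1 = 1}

section Gauge

variable {ι A : Type u} [CStarAlgebra A] {v : ι → A}

lemma IsIsometryFamily.circle_smul (hv : IsIsometryFamily v) (z : Circle) :
    IsIsometryFamily (fun i => (z : ℂ) • v i) := by
  have hz : star (z : ℂ) * (z : ℂ) = 1 := by
    simp [Complex.conj_mul', Circle.norm_coe]
  constructor
  · intro i
    rw [star_smul, smul_mul_smul_comm, hv.isometry, hz, one_smul]
  · intro i j hij
    rw [star_smul, smul_mul_smul_comm, hv.orthogonal i j hij, smul_zero]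

/-- The gauge action `γ`, characterized by `γ_z (v_i) = z v_i`. -/
noncomputable def IsToeplitzCuntz.gauge (hv : IsToeplitzCuntz v) (z : Circle) : A →⋆ₐ[ℂ] A :=
  (hv.universal A _ (hv.family.circle_smul z)).choose

lemma IsToeplitzCuntz.gauge_apply (hv : IsToeplitzCuntz v) (z : Circle) (i : ι) :
    hv.gauge z (v i) = (z : ℂ) • v i :=
  (hv.universal A _ (hv.family.circle_smul z)).choose_spec i

/-- The fixed-point algebra of the gauge action. -/
noncomputable def IsToeplitzCuntz.fixedPointAlgebra (hv : IsToeplitzCuntz v) :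
    StarSubalgebra ℂ A where
  carrier := {a | ∀ z, hv.gauge z a = a}
  mul_mem' ha hb z := by rw [map_mul, ha z, hb z]
  one_mem' z := map_one _
  add_mem' ha hb z := by rw [map_add, ha z, hb z]
  zero_mem' z := map_zero _
  algebraMap_mem' r z := AlgHomClass.commutes _ r
  star_mem' ha z := by rw [map_star, ha z]

instance IsToeplitzCuntz.isClosed_fixedPointAlgebra (hv : IsToeplitzCuntz v) :
    IsClosed (hv.fixedPointAlgebra : Set A) := by
  have : (hv.fixedPointAlgebra : Set A) = ⋂ z, {a | hv.gauge z a = a} := by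
    ext a
    simp [IsToeplitzCuntz.fixedPointAlgebra]
  rw [this]
  exact isClosed_iInter fun z => isClosed_eq (AddMonoidHomClass.continuous_of_bound (hv.gauge z) 1 fun a => by
    simpa using NonUnitalStarAlgHom.norm_apply_le (hv.gauge z) a) continuous_id

lemma IsToeplitzCuntz.gauge_word (hv : IsToeplitzCuntz v) (z : Circle) {k : ℕ} (μ : Fin k → ι) :
    hv.gauge z (word v μ) = (z : ℂ) ^ k • word v μ := by
  induction k with
  | zero => simp [word]
  | succ k ih =>
    have h : word v μ = v (μ 0) * word v (fun a : Fin k => μ a.succ) := by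
      simp [word, List.ofFn_succ]
    rw [h, map_mul, hv.gauge_apply, ih, smul_mul_smul_comm, pow_succ']

lemma IsToeplitzCuntz.word_mul_star_word_mem (hv : IsToeplitzCuntz v) {m : ℕ}
    (μ ν : Fin m → ι) : word v μ * star (word v ν) ∈ hv.fixedPointAlgebra := by
  intro z
  have hz : (z : ℂ) * star (z : ℂ) = 1 := by
    simp [Complex.mul_conj', Circle.norm_coe]
  rw [map_mul, map_star, hv.gauge_word, hv.gauge_word, star_smul, smul_mul_smul_comm, star_pow,
    ← mul_pow, hz, one_pow, one_smul]

/-- `ρ` is the product state of the fixed-point algebra given by the vector states of a sequence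
of unit vectors; `e k` is the `(k+1)`-st vector of the sequence. -/
def IsToeplitzCuntz.IsProductState (hv : IsToeplitzCuntz v) (e : ℕ → A)
    (ρ : StrongDual ℂ hv.fixedPointAlgebra) : Prop :=
  ρ ∈ stateSpace hv.fixedPointAlgebra ∧
    ∀ (m : ℕ) (μ ν : Fin m → ι),
      ρ ⟨word v μ * star (word v ν), hv.word_mul_star_word_mem μ ν⟩ =
        (∏ a : Fin m, ip (v (μ a)) (e a)) * ∏ b : Fin m, ip (e b) (v (ν b))

/-- The states of the whole algebra which extend `ρ`. -/
def IsToeplitzCuntz.stateExtensions (hv : IsToeplitzCuntz v)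
    (ρ : StrongDual ℂ hv.fixedPointAlgebra) : Set (StrongDual ℂ A) :=
  {φ | φ ∈ stateSpace A ∧ ∀ a : hv.fixedPointAlgebra, φ a = ρ a}

end Gauge

/-- `p` is the (finite) period of the sequence `e`. -/
def HasPeriod {A : Type u} [CStarAlgebra A] (e : ℕ → A) (p : ℕ) : Prop :=
  IsLeast {q : ℕ | 0 < q ∧ Summable fun i => 1 - ‖ip (e i) (e (i + q))‖} p

noncomputable instance : MeasurableSpace Circle := borel Circle

instance : BorelSpace Circle := ⟨rfl⟩

/-- Fourier coefficients of a probability measure on the circle. -/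
noncomputable def fourierCoeff (σ : ProbabilityMeasure Circle) (m : ℤ) : ℂ :=
  ∫ z : Circle, (z : ℂ) ^ (-m) ∂(σ : Measure Circle)

/-- The coefficients `λ_{k,l}`. -/
noncomputable def coeff {A : Type u} [CStarAlgebra A] (e : ℕ → A) (p : ℕ)
    (σ : ProbabilityMeasure Circle) (k l : ℕ) : ℂ :=
  if (p : ℤ) ∣ (k : ℤ) - l then
    fourierCoeff σ (((k : ℤ) - l) / p) * ∏' i : ℕ, ip (e (l + i)) (e (k + i))
  else 0

end ToeplitzCuntz

/-! Write `E_k = e 0 ⋯ e (k-1)` (`segment e 0 k`) and `P_k = E_k E_k⋆` (`segmentProj e k`). Since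
`star g * f` is a scalar for `f`, `g` in the fiber, `P_k (v_μ v_ν⋆) P_l` is a scalar multiple of
`E_k E_l⋆`, the scalar being the product of inner products in the theorem. A state with value 1 on a
projection may be compressed by it, so a state with value 1 on all `P_N` is determined by the
numbers `φ(E_k E_l⋆)`. On the fixed-point algebra only `k = l` occurs, which identifies the product
state; an average of numbers at most 1 equals 1 only if all do, which gives purity.

Let `φ` extend `ρ`. Compressing again gives `φ(E_k E_l⋆) = (∏_{j<i} ⟨e_{l+j}, e_{k+j}⟩) φ(E_{k+i}
E_{l+i}⋆)` (`state_segment`). If `p ∤ k - l` the products tend to 0. If `k - l = p m` they converge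
and `φ(E_{k+n} E_{l+n}⋆)` tends to a number `c m` depending on `m` alone. The sequence `c` is
positive definite with `c 0 = 1`, so Herglotz' theorem yields `σ` (`exists_measure_of_state`). The
measure is recovered from far-out coefficients, whose infinite products are nonzero
(`measure_eq_of_coeff`).

Conversely, given `σ`, take the vacuum state `ω` of the Fock representation, for which the `E_k` are
orthonormal, and average `σ̂(i-j) ω(E_{n+ip}⋆ a E_{n+jp})` over `i, j < n`. These are states
(`approxState_mem`), their values on words converge to the required ones (`tendsto_approxState`),
and weak-star compactness gives the extension (`exists_extension`). -/

namespace ToeplitzCuntz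

open Filter Topology

/-! ### States: Cauchy-Schwarz, supports, weak-star compactness. -/

section States

variable {A : Type u} [CStarAlgebra A] {φ : StrongDual ℂ A}

/-- Polarization: the values of `φ` on the squares of `x`, `y`, `x + y` and `x + i y` are real. -/
lemma stateSpace_conj_symm (hφ : φ ∈ stateSpace A) (x y : A) :
    (starRingEnd ℂ) (φ (star y * x)) = φ (star x * y) := by
  have hxx := (Complex.nonneg_iff.1 (hφ.1 x)).2
  have hyy := (Complex.nonneg_iff.1 (hφ.1 y)).2
  have h1 := (Complex.nonneg_iff.1 (hφ.1 (x + y))).2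
  have h2 := (Complex.nonneg_iff.1 (hφ.1 (x + Complex.I • y))).2
  simp only [star_add, add_mul, mul_add, map_add, star_smul, smul_mul_assoc, mul_smul_comm,
    map_smul, smul_eq_mul, Complex.add_im, Complex.mul_im, Complex.I_re, Complex.I_im,
    RCLike.star_def, Complex.conj_I, Complex.neg_re, Complex.neg_im, Complex.mul_re] at h1 h2
  apply Complex.ext
  · rw [Complex.conj_re]
    linarith
  · rw [Complex.conj_im]
    linarith

/-- The Cauchy-Schwarz inequality for states. -/
lemma stateSpace_norm_sq_le (hφ : φ ∈ stateSpace A) (x y : A) :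
    ‖φ (star x * y)‖ ^ 2 ≤ (φ (star x * x)).re * (φ (star y * y)).re := by
  let c : PreInnerProductSpace.Core ℂ A :=
    { inner := fun x y => φ (star x * y)
      conj_inner_symm := fun x y => stateSpace_conj_symm hφ x y
      re_inner_nonneg := fun x => (Complex.nonneg_iff.1 (hφ.1 x)).1
      add_left := fun x y z => by simp [add_mul]
      smul_left := fun x y r => by simp }
  have h := @InnerProductSpace.Core.inner_mul_inner_self_le ℂ A _ _ _ c x y
  have e : ‖φ (star y * x)‖ = ‖φ (star x * y)‖ := by
    rw [← stateSpace_conj_symm hφ x y, RCLike.norm_conj]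
  change ‖φ (star x * y)‖ * ‖φ (star y * x)‖ ≤ _ at h
  rw [e, ← sq] at h
  exact h

/-- Cauchy-Schwarz against `1`, together with `‖a‖² - a⋆a = y⋆y` for some `y`. It places all states
in the weak-star compact unit ball. -/
lemma stateSpace_norm_apply_le (hφ : φ ∈ stateSpace A) (a : A) : ‖φ a‖ ≤ ‖a‖ := by
  have h := stateSpace_norm_sq_le hφ 1 a
  simp only [star_one, one_mul, hφ.2, Complex.one_re] at h
  have h2 : (φ (star a * a)).re ≤ ‖a‖ ^ 2 := by
    let _ := CStarAlgebra.spectralOrder A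
    let _ := CStarAlgebra.spectralOrderedRing A
    have h3 := CStarAlgebra.star_mul_le_algebraMap_norm_sq (a := a)
    rw [← sub_nonneg] at h3
    obtain ⟨y, hy⟩ := CStarAlgebra.nonneg_iff_eq_star_mul_self.1 h3
    have h4 := (Complex.nonneg_iff.1 (hφ.1 y)).1
    rw [← hy, Algebra.algebraMap_eq_smul_one, map_sub, ← Complex.coe_smul, map_smul, hφ.2] at h4
    simp only [Complex.sub_re, smul_eq_mul, mul_one, Complex.ofReal_re] at h4
    linarith
  exact le_of_sq_le_sq (h.trans h2) (norm_nonneg a)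

/-- A state is supported on each projection where it takes the value one. -/
lemma stateSpace_mul_right (hφ : φ ∈ stateSpace A) {q : A} (hq : star q = q) (hqq : q * q = q)
    (h1 : φ q = 1) (a : A) : φ (a * q) = φ a := by
  have h := stateSpace_norm_sq_le hφ (star a) (1 - q)
  have e : star (1 - q) * (1 - q) = 1 - q := by
    simp [hq, sub_mul, mul_sub, hqq]
  rw [e, map_sub, hφ.2, h1, star_star, mul_sub, mul_one, map_sub] at h
  simp only [sub_self, Complex.zero_re, mul_zero] at h
  have := pow_eq_zero_iff (two_ne_zero) |>.1 (le_antisymm h (by positivity))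
  exact (sub_eq_zero.1 (norm_eq_zero.1 this)).symm

lemma stateSpace_mul_left (hφ : φ ∈ stateSpace A) {q : A} (hq : star q = q) (hqq : q * q = q)
    (h1 : φ q = 1) (a : A) : φ (q * a) = φ a := by
  have h := stateSpace_mul_right hφ hq hqq h1 (star a)
  have h2 := stateSpace_conj_symm hφ (star a) 1
  have h3 := stateSpace_conj_symm hφ (star a * q) 1
  simp only [star_one, one_mul, mul_one, star_mul, star_star, hq] at h2 h3
  rw [← h3, h, h2]

/-- A sequence of states has a weak-star cluster point among the states. -/
lemma exists_state_of_tendsto (φ : ℕ → StrongDual ℂ A) (hφ : ∀ n, φ n ∈ stateSpace A) :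
    ∃ ψ ∈ stateSpace A, ∀ a L, Tendsto (fun n => φ n a) atTop (𝓝 L) → ψ a = L := by
  have hK : IsCompact (WeakDual.toStrongDual ⁻¹' Metric.closedBall (0 : StrongDual ℂ A) 1) :=
    WeakDual.isCompact_closedBall 0 1
  -- A limit along a nonprincipal ultrafilter exists by Banach-Alaoglu and agrees with every
  -- ordinary limit, so separability of `A` plays no role.
  let U : Ultrafilter (WeakDual ℂ A) :=
    (hyperfilter ℕ).map fun n => StrongDual.toWeakDual (φ n)
  have hU : (U : Filter (WeakDual ℂ A)) ≤
      𝓟 (WeakDual.toStrongDual ⁻¹' Metric.closedBall (0 : StrongDual ℂ A) 1) := by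
    rw [le_principal_iff]
    refine Filter.mem_map.2 (Filter.univ_mem' fun n => ?_)
    change φ n ∈ Metric.closedBall (0 : StrongDual ℂ A) 1
    rw [mem_closedBall_zero_iff]
    exact ContinuousLinearMap.opNorm_le_bound _ zero_le_one fun a => by
      rw [one_mul]; exact stateSpace_norm_apply_le (hφ n) a
  obtain ⟨ψ, -, hψ⟩ := hK.ultrafilter_le_nhds U hU
  have hlim : ∀ a, Tendsto (fun n => φ n a) (hyperfilter ℕ : Filter ℕ) (𝓝 (ψ a)) := by
    intro a
    have h1 : Tendsto (fun n => StrongDual.toWeakDual (φ n)) (hyperfilter ℕ : Filter ℕ) (𝓝 ψ) :=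
      hψ
    exact ((WeakDual.eval_continuous a).tendsto ψ).comp h1
  have hle : (hyperfilter ℕ : Filter ℕ) ≤ atTop := by
    rw [← Nat.cofinite_eq_atTop]; exact hyperfilter_le_cofinite
  refine ⟨WeakDual.toStrongDual ψ, ⟨fun a => ?_, ?_⟩, fun a L ha => ?_⟩
  · exact ge_of_tendsto (hlim _) (Filter.Eventually.of_forall fun n => (hφ n).1 a)
  · exact tendsto_nhds_unique (hlim 1) (by simp [fun n => (hφ n).2])
  · exact tendsto_nhds_unique (hlim a) (ha.mono_left hle)

end States

/-! ### The Hilbert space structure of the fiber. -/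

section Fiber

variable {ι A : Type u} [CStarAlgebra A] {v : ι → A}

lemma mem_fiber (i : ι) : v i ∈ fiber v :=
  Submodule.le_topologicalClosure _ (Submodule.subset_span ⟨i, rfl⟩)

lemma fiber_induction {P : A → Prop} (hP : IsClosed {x | P x}) (h0 : P 0)
    (hadd : ∀ x y, P x → P y → P (x + y)) (hsmul : ∀ (c : ℂ) x, P x → P (c • x))
    (hv : ∀ i, P (v i)) {x : A} (hx : x ∈ fiber v) : P x := by
  refine closure_minimal (fun y hy => ?_) hP hx
  induction hy using Submodule.span_induction with
  | mem y hy => obtain ⟨i, rfl⟩ := hy; exact hv i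
  | zero => exact h0
  | add a b _ _ ha hb => exact hadd a b ha hb
  | smul c a _ ha => exact hsmul c a ha

variable [Nontrivial A] (hv : IsIsometryFamily v)
include hv

lemma norm_ip_le {f g : A} (hf : f ∈ fiber v) (hg : g ∈ fiber v) : ‖ip f g‖ ≤ ‖f‖ * ‖g‖ := by
  have h := congrArg norm (star_mul_eq_ip hv hf hg)
  rw [norm_smul, CStarRing.norm_one, mul_one] at h
  rw [← h, mul_comm]
  simpa using norm_mul_le (star g) f

lemma ip_conj {f g : A} (hf : f ∈ fiber v) (hg : g ∈ fiber v) :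
    (starRingEnd ℂ) (ip f g) = ip g f := by
  have h1 := congrArg star (star_mul_eq_ip hv hf hg)
  rw [star_mul, star_star, star_mul_eq_ip hv hg hf, star_smul, star_one] at h1
  exact (smul_left_injective ℂ one_ne_zero h1).symm

lemma norm_ip_comm {f g : A} (hf : f ∈ fiber v) (hg : g ∈ fiber v) : ‖ip f g‖ = ‖ip g f‖ := by
  rw [← ip_conj hv hf hg, RCLike.norm_conj]

lemma ip_eq_of_star_mul {f g : A} (hf : f ∈ fiber v) (hg : g ∈ fiber v) {c : ℂ}
    (h : star g * f = c • (1 : A)) : ip f g = c := by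
  rw [star_mul_eq_ip hv hf hg] at h
  exact smul_left_injective ℂ one_ne_zero h

lemma ip_sub_left {f f' g : A} (hf : f ∈ fiber v) (hf' : f' ∈ fiber v) (hg : g ∈ fiber v) :
    ip (f - f') g = ip f g - ip f' g :=
  ip_eq_of_star_mul hv (Submodule.sub_mem _ hf hf') hg (by
    rw [mul_sub, star_mul_eq_ip hv hf hg, star_mul_eq_ip hv hf' hg, sub_smul])

lemma ip_smul_left {f g : A} (c : ℂ) (hf : f ∈ fiber v) (hg : g ∈ fiber v) :
    ip (c • f) g = c * ip f g :=
  ip_eq_of_star_mul hv (Submodule.smul_mem _ c hf) hg (by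
    rw [mul_smul_comm, star_mul_eq_ip hv hf hg, smul_smul])

lemma ip_sub_right {f g g' : A} (hf : f ∈ fiber v) (hg : g ∈ fiber v) (hg' : g' ∈ fiber v) :
    ip f (g - g') = ip f g - ip f g' :=
  ip_eq_of_star_mul hv hf (Submodule.sub_mem _ hg hg') (by
    rw [star_sub, sub_mul, star_mul_eq_ip hv hf hg, star_mul_eq_ip hv hf hg', sub_smul])

lemma ip_self {f : A} (hf : f ∈ fiber v) : ip f f = ((‖f‖ ^ 2 : ℝ) : ℂ) := by
  have h1 := congrArg norm (star_mul_eq_ip hv hf hf)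
  rw [norm_smul, CStarRing.norm_one, mul_one, CStarRing.norm_star_mul_self, ← sq] at h1
  have h2 := star_mul_eq_ip hv hf hf
  let _ := CStarAlgebra.spectralOrder A
  let _ := CStarAlgebra.spectralOrderedRing A
  have hpos : (0 : A) ≤ algebraMap ℂ A (ip f f) := by
    rw [Algebra.algebraMap_eq_smul_one, ← h2]; exact star_mul_self_nonneg f
  have hc := ip_conj hv hf hf
  have him : (ip f f).im = 0 := Complex.conj_eq_iff_im.1 hc
  have hre : ip f f = (((ip f f).re : ℝ) : ℂ) := Complex.ext (by simp) (by simp [him])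
  have hre0 : 0 ≤ (ip f f).re := by
    -- The norm identity fixes only the modulus of `ip f f`; the sign comes from the spectrum of the
    -- positive scalar element `f⋆f`.
    have := spectrum_nonneg_of_nonneg (𝕜 := ℝ) (a := algebraMap ℂ A (ip f f)) hpos
      (x := (ip f f).re) (by
        have : algebraMap ℂ A (ip f f) = algebraMap ℝ A (ip f f).re := by
          conv_lhs => rw [hre]
          rw [Algebra.algebraMap_eq_smul_one, Algebra.algebraMap_eq_smul_one, Complex.coe_smul]
        rw [this, spectrum.scalar_eq]; rfl)
    exact this
  rw [h1]
  rw [hre, Complex.norm_real, Real.norm_of_nonneg hre0]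

/-- The norm distance of unit vectors in terms of their inner product. -/
lemma norm_sub_sq_eq {f g : A} (hf : f ∈ fiber v) (hg : g ∈ fiber v) (h1 : ‖f‖ = 1)
    (h2 : ‖g‖ = 1) : ‖f - g‖ ^ 2 = 2 * (1 - (ip f g).re) := by
  have hs := Submodule.sub_mem _ hf hg
  have h := ip_self hv hs
  rw [ip_sub_left hv hf hg hs, ip_sub_right hv hf hf hg, ip_sub_right hv hg hf hg, ip_self hv hf,
    ip_self hv hg, h1, h2, ← ip_conj hv hf hg] at h
  have := congrArg Complex.re h
  simp only [Complex.sub_re, Complex.ofReal_re, Complex.conj_re] at this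
  linarith

end Fiber

/-! ### Fock representation and vacuum state. -/

section Fock

open scoped InnerProductSpace

variable {ι : Type u}

/-- The Fock space over the Hilbert space with orthonormal basis `ι`. -/
abbrev Fock (ι : Type u) : Type u := lp (fun _ : List ι => ℂ) 2

open Classical in
/-- The basis vectors of the Fock space. -/
noncomputable def fockVec (w : List ι) : Fock ι := lp.single 2 w (1 : ℂ)

lemma orthonormal_fockVec : Orthonormal ℂ (fockVec (ι := ι)) := by
  classical
  rw [orthonormal_iff_ite]
  intro i j
  rw [fockVec, fockVec, lp.inner_single_left, lp.single_apply]
  by_cases h : i = j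
  · subst h; simp
  · simp [h]

lemma orthonormal_fockVec_cons (i : ι) : Orthonormal ℂ fun w : List ι => fockVec (i :: w) :=
  orthonormal_fockVec.comp _ (List.cons_injective)

/-- The creation operators on the Fock space. -/
noncomputable def creation (i : ι) : Fock ι →L[ℂ] Fock ι :=
  ((orthonormal_fockVec_cons i).orthogonalFamily.linearIsometry).toContinuousLinearMap

lemma hasSum_creation (i : ι) (x : Fock ι) :
    HasSum (fun w => x w • fockVec (i :: w)) (creation i x) :=
  (orthonormal_fockVec_cons i).orthogonalFamily.hasSum_linearIsometry x

lemma inner_creation_eq_zero {y : Fock ι} (i : ι) (h : ∀ w, ⟪y, fockVec (i :: w)⟫_ℂ = 0)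
    (x : Fock ι) : ⟪y, creation i x⟫_ℂ = 0 := by
  have h1 := (hasSum_creation i x).mapL (innerSL ℂ y)
  simp only [innerSL_apply_apply, inner_smul_right, h, mul_zero] at h1
  exact (h1.unique hasSum_zero)

lemma isIsometryFamily_creation : IsIsometryFamily (creation (ι := ι)) := by
  constructor
  · intro i
    exact (ContinuousLinearMap.norm_map_iff_adjoint_comp_self _).1
      (orthonormal_fockVec_cons i).orthogonalFamily.linearIsometry.norm_map
  · intro i j hij
    ext1 x
    refine ext_inner_left ℂ fun y => ?_
    change ⟪y, ContinuousLinearMap.adjoint (creation j) (creation i x)⟫_ℂ = ⟪y, 0⟫_ℂ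
    rw [ContinuousLinearMap.adjoint_inner_right, inner_zero_right]
    refine inner_creation_eq_zero i (fun w => ?_) x
    rw [← inner_conj_symm, inner_creation_eq_zero j, map_zero]
    intro w'
    refine orthonormal_fockVec.2 fun h => hij ?_
    exact (List.cons_eq_cons.1 h).1

/-- The vacuum state of the Toeplitz-Cuntz algebra. -/
lemma IsToeplitzCuntz.exists_vacuum {A : Type u} [CStarAlgebra A] {v : ι → A}
    (hv : IsToeplitzCuntz v) :
    ∃ ω ∈ stateSpace A, ∀ x ∈ fiber v, ∀ y, ω (x * y) = 0 ∧ ω (y * star x) = 0 := by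
  obtain ⟨π, hπ⟩ := hv.universal (Fock ι →L[ℂ] Fock ι) creation isIsometryFamily_creation
  have hcont : Continuous π := AddMonoidHomClass.continuous_of_bound π 1 fun a => by
    simpa using NonUnitalStarAlgHom.norm_apply_le π a
  let Ω : Fock ι := fockVec []
  let ω : StrongDual ℂ A :=
    { toFun := fun a => ⟪Ω, π a Ω⟫_ℂ
      map_add' := fun a b => by rw [map_add, add_apply, inner_add_right]
      map_smul' := fun c a => by
        rw [map_smul, smul_apply, inner_smul_right]; rfl
      cont := by fun_prop }
  have hω : ∀ a, ω a = ⟪Ω, π a Ω⟫_ℂ := fun a => rfl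
  have key : ∀ a b, ω (star a * b) = ⟪π a Ω, π b Ω⟫_ℂ := by
    intro a b
    rw [hω, map_mul, map_star, mul_apply_eq_comp,
      ContinuousLinearMap.star_eq_adjoint, ContinuousLinearMap.adjoint_inner_right]
  have hst : ω ∈ stateSpace A := by
    refine ⟨fun a => ?_, ?_⟩
    · rw [key]
      rw [inner_self_eq_norm_sq_to_K]
      exact pow_nonneg (RCLike.ofReal_nonneg.2 (norm_nonneg _)) 2
    · rw [hω, map_one, one_apply_eq_self, inner_self_eq_norm_sq_to_K,
        orthonormal_fockVec.1]
      simp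
  have h1 : ∀ i y, ω (v i * y) = 0 := by
    intro i y
    rw [hω, map_mul, hπ, mul_apply_eq_comp]
    exact inner_creation_eq_zero i (fun w => orthonormal_fockVec.2 (by simp)) _
  have h2 : ∀ x ∈ fiber v, ∀ y, ω (x * y) = 0 := by
    intro x hx y
    refine fiber_induction (P := fun x => ω (x * y) = 0) ?_ (by simp) ?_ ?_ (fun i => h1 i y) hx
    · exact isClosed_eq (by fun_prop) continuous_const
    · intro a b ha hb; rw [add_mul, map_add, ha, hb, add_zero]
    · intro c a ha; rw [smul_mul_assoc, map_smul, ha, smul_zero]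
  refine ⟨ω, hst, fun x hx y => ⟨h2 x hx y, ?_⟩⟩
  have := stateSpace_conj_symm hst (star y) (star x)
  rw [star_star, star_star, h2 x hx, map_zero] at this
  exact this.symm

end Fock

/-! ### Density of the words, and averaging over the gauge action. -/

section Words

variable {ι A : Type u} [CStarAlgebra A] {v : ι → A}

lemma word_zero (μ : Fin 0 → ι) : word v μ = 1 := by simp [word]

lemma word_succ {k : ℕ} (μ : Fin (k + 1) → ι) :
    word v μ = v (μ 0) * word v (fun a : Fin k => μ a.succ) := by
  simp [word, List.ofFn_succ]

lemma word_cons {k : ℕ} (i : ι) (μ : Fin k → ι) :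
    word v (Fin.cons i μ : Fin (k + 1) → ι) = v i * word v μ := by
  simp [word_succ]

lemma word_snoc {k : ℕ} (i : ι) (μ : Fin k → ι) :
    word v (Fin.snoc (α := fun _ => ι) μ i : Fin (k + 1) → ι) = word v μ * v i := by
  simp only [word, List.ofFn_succ' (n := k), Fin.snoc_castSucc, Fin.snoc_last,
    List.concat_eq_append, List.prod_append, List.prod_singleton]

/-- The products `v_μ v_ν⋆`. -/
def wordProducts (v : ι → A) : Set A :=
  {a | ∃ (k l : ℕ) (μ : Fin k → ι) (ν : Fin l → ι), a = word v μ * star (word v ν)}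

lemma IsIsometryFamily.star_mul_mem_span (hv : IsIsometryFamily v) (i : ι) {a : A}
    (ha : a ∈ wordProducts v) : star (v i) * a ∈ Submodule.span ℂ (wordProducts v) := by
  obtain ⟨k, l, μ, ν, rfl⟩ := ha
  cases k with
  | zero =>
    refine Submodule.subset_span ⟨0, l + 1, μ, Fin.snoc (α := fun _ => ι) ν i, ?_⟩
    rw [word_zero, one_mul, one_mul, word_snoc, star_mul]
  | succ k =>
    rw [word_succ, mul_assoc, ← mul_assoc]
    by_cases h : μ 0 = i
    · rw [h, hv.isometry, one_mul]
      exact Submodule.subset_span ⟨k, l, _, ν, rfl⟩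
    · rw [hv.orthogonal _ _ h, zero_mul]
      exact Submodule.zero_mem _

/-- The span of the `v_μ v_ν⋆` is stable under left multiplication by each `v_i` and `v_i⋆`, hence
by the whole ⋆-algebra, and it contains `1`. -/
lemma IsIsometryFamily.adjoin_le_span (hv : IsIsometryFamily v) {a : A}
    (ha : a ∈ StarAlgebra.adjoin ℂ (Set.range v)) : a ∈ Submodule.span ℂ (wordProducts v) := by
  let W := Submodule.span ℂ (wordProducts v)
  -- Treating `a` and `star a` together lets the induction pass through adjoints.
  have key : (∀ w ∈ W, a * w ∈ W) ∧ (∀ w ∈ W, star a * w ∈ W) := by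
    induction ha using StarAlgebra.adjoin_induction with
    | mem x hx =>
      obtain ⟨i, rfl⟩ := hx
      constructor
      · intro w hw
        induction hw using Submodule.span_induction with
        | mem y hy =>
          obtain ⟨k, l, μ, ν, rfl⟩ := hy
          exact Submodule.subset_span ⟨k + 1, l, Fin.cons i μ, ν, by rw [word_cons, mul_assoc]⟩
        | zero => simp
        | add a b _ _ ha hb => rw [mul_add]; exact W.add_mem ha hb
        | smul c a _ ha => rw [mul_smul_comm]; exact W.smul_mem c ha
      · intro w hw
        induction hw using Submodule.span_induction with
        | mem y hy => exact hv.star_mul_mem_span i hy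
        | zero => simp
        | add a b _ _ ha hb => rw [mul_add]; exact W.add_mem ha hb
        | smul c a _ ha => rw [mul_smul_comm]; exact W.smul_mem c ha
    | algebraMap r =>
      have : ∀ r : ℂ, ∀ w ∈ W, algebraMap ℂ A r * w ∈ W := fun r w hw => by
        rw [← Algebra.smul_def]; exact W.smul_mem r hw
      refine ⟨this r, ?_⟩
      rw [← algebraMap_star_comm]
      exact this _
    | add x y _ _ hx hy =>
      refine ⟨fun w hw => ?_, fun w hw => ?_⟩
      · rw [add_mul]; exact W.add_mem (hx.1 w hw) (hy.1 w hw)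
      · rw [star_add, add_mul]; exact W.add_mem (hx.2 w hw) (hy.2 w hw)
    | mul x y _ _ hx hy =>
      refine ⟨fun w hw => ?_, fun w hw => ?_⟩
      · rw [mul_assoc]; exact hx.1 _ (hy.1 w hw)
      · rw [star_mul, mul_assoc]; exact hy.2 _ (hx.2 w hw)
    | star x _ hx => exact ⟨hx.2, by rw [star_star]; exact hx.1⟩
  have h1 : (1 : A) ∈ W :=
    Submodule.subset_span ⟨0, 0, Fin.elim0, Fin.elim0, by simp [word_zero]⟩
  simpa using key.1 1 h1

lemma IsToeplitzCuntz.mem_closure_span (hv : IsToeplitzCuntz v) (a : A) :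
    a ∈ closure (Submodule.span ℂ (wordProducts v) : Set A) := by
  have h : a ∈ (StarAlgebra.adjoin ℂ (Set.range v)).topologicalClosure := by
    rw [hv.generates]; trivial
  exact closure_mono (fun b hb => hv.family.adjoin_le_span hb) h

lemma IsToeplitzCuntz.dual_ext (hv : IsToeplitzCuntz v) {φ ψ : StrongDual ℂ A}
    (h : ∀ (k l : ℕ) (μ : Fin k → ι) (ν : Fin l → ι),
      φ (word v μ * star (word v ν)) = ψ (word v μ * star (word v ν))) : φ = ψ := by
  ext a
  refine closure_minimal (s := (Submodule.span ℂ (wordProducts v) : Set A))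
    (t := {a | φ a = ψ a}) (fun b hb => ?_) (isClosed_eq φ.continuous ψ.continuous)
    (hv.mem_closure_span a)
  induction hb using Submodule.span_induction with
  | mem y hy => obtain ⟨k, l, μ, ν, rfl⟩ := hy; exact h k l μ ν
  | zero => simp
  | add a b _ _ ha hb => change φ _ = ψ _ ; rw [map_add, map_add, ha, hb]
  | smul c a _ ha => change φ _ = ψ _ ; rw [map_smul, map_smul, ha]

/-- Averages of the gauge action over roots of unity. -/
noncomputable def IsToeplitzCuntz.rootAverage (hv : IsToeplitzCuntz v) (N : ℕ) (a : A) : A :=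
  (N : ℂ)⁻¹ • ∑ j ∈ Finset.range N, hv.gauge (Circle.exp (2 * Real.pi / N) ^ j) a

lemma sum_rootsOfUnity_zpow (N : ℕ) (d : ℤ) (hd : d.natAbs < N) :
    (N : ℂ)⁻¹ * ∑ j ∈ Finset.range N, (((Circle.exp (2 * Real.pi / N) ^ j : Circle) : ℂ)) ^ d =
      if d = 0 then 1 else 0 := by
  have hN : N ≠ 0 := by omega
  have hN' : (N : ℂ) ≠ 0 := by exact_mod_cast hN
  have hζ : IsPrimitiveRoot ((Circle.exp (2 * Real.pi / N) : Circle) : ℂ) N := by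
    have := Complex.isPrimitiveRoot_exp N hN
    convert this using 1
    rw [Circle.coe_exp]
    congr 1
    push_cast
    ring
  split_ifs with h
  · subst h; simp [hN']
  · have e : ∀ j : ℕ, (((Circle.exp (2 * Real.pi / N) ^ j : Circle) : ℂ)) ^ d =
        (((Circle.exp (2 * Real.pi / N) : Circle) : ℂ) ^ d) ^ j := by
      intro j
      rw [Circle.coe_pow, ← zpow_natCast, ← zpow_natCast, ← zpow_mul, ← zpow_mul, mul_comm d]
    simp only [e]
    have hne : ((Circle.exp (2 * Real.pi / N) : Circle) : ℂ) ^ d ≠ 1 := by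
      rw [Ne, hζ.zpow_eq_one_iff_dvd]
      intro hdvd
      have := Int.natAbs_dvd_natAbs.2 hdvd
      rw [Int.natAbs_natCast] at this
      exact h (Int.natAbs_eq_zero.1 (Nat.eq_zero_of_dvd_of_lt this hd))
    rw [geom_sum_eq hne, ← zpow_natCast, ← zpow_mul, mul_comm d, zpow_mul, zpow_natCast,
      hζ.pow_eq_one, one_zpow, sub_self, zero_div, mul_zero]

/-- With `|k - l| < N`, averaging over `N`-th roots of unity already acts on such a word as the Haar
integral of the gauge action would. -/
lemma IsToeplitzCuntz.rootAverage_word (hv : IsToeplitzCuntz v) {N k l : ℕ} (hk : k < N)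
    (hl : l < N) (μ : Fin k → ι) (ν : Fin l → ι) :
    hv.rootAverage N (word v μ * star (word v ν)) =
      if k = l then word v μ * star (word v ν) else 0 := by
  have e : ∀ z : Circle, hv.gauge z (word v μ * star (word v ν)) =
      ((z : ℂ) ^ ((k : ℤ) - l)) • (word v μ * star (word v ν)) := by
    intro z
    rw [map_mul, map_star, hv.gauge_word, hv.gauge_word, star_smul, smul_mul_smul_comm]
    congr 1
    rw [zpow_sub₀ (Circle.coe_ne_zero z), zpow_natCast, zpow_natCast, div_eq_mul_inv, star_pow,
      ← inv_pow, ← Circle.coe_inv, Circle.coe_inv_eq_conj]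
    rfl
  simp only [rootAverage, e]
  rw [← Finset.sum_smul, smul_smul, sum_rootsOfUnity_zpow N _ (by omega)]
  by_cases h : k = l
  · simp [h]
  · rw [if_neg (by omega), if_neg h, zero_smul]

/-- Bounded functionals on the fixed point algebra are determined by their values on words. -/
lemma IsToeplitzCuntz.fixedPoint_dual_ext (hv : IsToeplitzCuntz v)
    {φ ψ : StrongDual ℂ hv.fixedPointAlgebra}
    (h : ∀ (m : ℕ) (μ ν : Fin m → ι),
      φ ⟨word v μ * star (word v ν), hv.word_mul_star_word_mem μ ν⟩ =
      ψ ⟨word v μ * star (word v ν), hv.word_mul_star_word_mem μ ν⟩) : φ = ψ := by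
  -- A large enough average kills every unbalanced word of `b`, leaving balanced words, where `φ`
  -- and `ψ` agree.
  have hmem : ∀ b ∈ Submodule.span ℂ (wordProducts v), ∃ N₀ : ℕ, ∀ N ≥ N₀,
      ∃ hb : hv.rootAverage N b ∈ hv.fixedPointAlgebra, φ ⟨_, hb⟩ = ψ ⟨_, hb⟩ := by
    intro b hb
    induction hb using Submodule.span_induction with
    | mem y hy =>
      obtain ⟨k, l, μ, ν, rfl⟩ := hy
      refine ⟨k + l + 1, fun N hN => ?_⟩
      rw [hv.rootAverage_word (by omega) (by omega)]
      by_cases hkl : k = l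
      · subst hkl
        simp only [if_true]
        exact ⟨hv.word_mul_star_word_mem μ ν, h k μ ν⟩
      · simp only [if_neg hkl]
        exact ⟨zero_mem _, by
          have : (⟨0, zero_mem _⟩ : hv.fixedPointAlgebra) = 0 := rfl
          rw [this, map_zero, map_zero]⟩
    | zero =>
      refine ⟨0, fun N _ => ?_⟩
      have e : hv.rootAverage N 0 = 0 := by simp [rootAverage]
      rw [e]
      exact ⟨zero_mem _, by
          have : (⟨0, zero_mem _⟩ : hv.fixedPointAlgebra) = 0 := rfl
          rw [this, map_zero, map_zero]⟩
    | add a b _ _ ha hb =>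
      obtain ⟨N₁, h1⟩ := ha
      obtain ⟨N₂, h2⟩ := hb
      refine ⟨max N₁ N₂, fun N hN => ?_⟩
      obtain ⟨m1, e1⟩ := h1 N (le_of_max_le_left hN)
      obtain ⟨m2, e2⟩ := h2 N (le_of_max_le_right hN)
      have e : hv.rootAverage N (a + b) = hv.rootAverage N a + hv.rootAverage N b := by
        simp [rootAverage, Finset.sum_add_distrib]
      rw [e]
      refine ⟨add_mem m1 m2, ?_⟩
      have : (⟨_, add_mem m1 m2⟩ : hv.fixedPointAlgebra) = ⟨_, m1⟩ + ⟨_, m2⟩ := rfl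
      rw [this, map_add, map_add, e1, e2]
    | smul c a _ ha =>
      obtain ⟨N₁, h1⟩ := ha
      refine ⟨N₁, fun N hN => ?_⟩
      obtain ⟨m1, e1⟩ := h1 N hN
      have e : hv.rootAverage N (c • a) = c • hv.rootAverage N a := by
        simp only [rootAverage, map_smul, ← Finset.smul_sum]
        rw [smul_comm]
      rw [e]
      refine ⟨SMulMemClass.smul_mem c m1, ?_⟩
      have : (⟨_, SMulMemClass.smul_mem c m1⟩ : hv.fixedPointAlgebra) = c • ⟨_, m1⟩ := rfl
      rw [this, map_smul, map_smul, e1]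
  ext ⟨a, ha⟩
  by_contra hne
  let C := ‖φ - ψ‖
  have hd : 0 < ‖(φ - ψ) ⟨a, ha⟩‖ := norm_pos_iff.2 (sub_ne_zero.2 hne)
  -- The radius is chosen so that `C * ‖a - b‖` is smaller than `‖(φ - ψ) a‖`, contradicting `h4`.
  obtain ⟨b, hb, hab⟩ := Metric.mem_closure_iff.1 (hv.mem_closure_span a)
    (‖(φ - ψ) ⟨a, ha⟩‖ / (C + 1)) (by positivity)
  obtain ⟨N₀, hN₀⟩ := hmem b hb
  obtain ⟨hbm, hbe⟩ := hN₀ (N₀ + 1) (by omega)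
  set N := N₀ + 1 with hN
  have hN0 : (N : ℂ) ≠ 0 := by exact_mod_cast (by omega : N ≠ 0)
  -- Averaging fixes the gauge-invariant `a` and is contractive.
  have h1 : ‖a - hv.rootAverage N b‖ ≤ ‖a - b‖ := by
    have e : a - hv.rootAverage N b = (N : ℂ)⁻¹ • ∑ j ∈ Finset.range N,
        hv.gauge (Circle.exp (2 * Real.pi / N) ^ j) (a - b) := by
      simp only [map_sub, Finset.sum_sub_distrib, smul_sub, rootAverage, ha _, Finset.sum_const,
        Finset.card_range]
      rw [← Nat.cast_smul_eq_nsmul ℂ, smul_smul, inv_mul_cancel₀ hN0, one_smul]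
    rw [e, norm_smul, norm_inv, Complex.norm_natCast]
    have h2 : ‖∑ j ∈ Finset.range N, hv.gauge (Circle.exp (2 * Real.pi / N) ^ j) (a - b)‖ ≤
        N * ‖a - b‖ := by
      refine (norm_sum_le_of_le _ fun j _ => NonUnitalStarAlgHom.norm_apply_le _ (a - b)).trans ?_
      simp
    have hNr : (0 : ℝ) < N := by exact_mod_cast (by omega : 0 < N)
    calc (N : ℝ)⁻¹ * _ ≤ (N : ℝ)⁻¹ * (N * ‖a - b‖) := by gcongr
      _ = ‖a - b‖ := by field_simp
  have h3 : (φ - ψ) ⟨a, ha⟩ = (φ - ψ) (⟨a, ha⟩ - ⟨_, hbm⟩) := by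
    rw [map_sub (φ - ψ)]
    have : (φ - ψ) ⟨_, hbm⟩ = 0 := sub_eq_zero.2 hbe
    rw [this, sub_zero]
  have h4 : ‖(φ - ψ) ⟨a, ha⟩‖ ≤ C * ‖a - b‖ := by
    rw [h3]
    refine ((φ - ψ).le_opNorm _).trans ?_
    exact mul_le_mul_of_nonneg_left h1 (norm_nonneg _)
  rw [dist_eq_norm, lt_div_iff₀ (by positivity)] at hab
  nlinarith [norm_nonneg (a - b)]

end Words

/-! ### Products of consecutive vectors of the sequence. -/

section Segments

variable {ι A : Type u} [CStarAlgebra A] {v : ι → A}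

/-- The product `e_l e_{l+1} ⋯ e_{l+i-1}`. -/
noncomputable def segment (e : ℕ → A) (l : ℕ) : ℕ → A
  | 0 => 1
  | i + 1 => segment e l i * e (l + i)

lemma segment_add (e : ℕ → A) (l i j : ℕ) :
    segment e l (i + j) = segment e l i * segment e (l + i) j := by
  induction j with
  | zero => simp [segment]
  | succ j ih => rw [← add_assoc, segment, ih, segment, mul_assoc, add_assoc]

variable (hv : IsIsometryFamily v) {e : ℕ → A} (he : ∀ k, e k ∈ fiber v)
include hv he

lemma star_segment_mul_segment (k l i : ℕ) :
    star (segment e k i) * segment e l i =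
      (∏ j ∈ Finset.range i, ip (e (l + j)) (e (k + j))) • (1 : A) := by
  induction i with
  | zero => simp [segment]
  | succ i ih =>
    rw [segment, segment, star_mul, mul_assoc, ← mul_assoc (star (segment e k i)), ih,
      smul_mul_assoc, one_mul, mul_smul_comm, star_mul_eq_ip hv (he _) (he _), smul_smul,
      Finset.prod_range_succ]

lemma star_segment_mul_word (k : ℕ) (μ : Fin k → ι) :
    star (segment e 0 k) * word v μ = (∏ a : Fin k, ip (v (μ a)) (e a)) • (1 : A) := by
  induction k with
  | zero => simp [segment, word_zero]
  | succ k ih =>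
    have h : word v μ = word v (fun a : Fin k => μ a.castSucc) * v (μ (Fin.last k)) := by
      rw [← word_snoc]
      congr 1
      exact (Fin.snoc_init_self μ).symm
    rw [h, segment, star_mul, mul_assoc, ← mul_assoc (star (segment e 0 k)), ih,
      smul_mul_assoc, one_mul, mul_smul_comm, star_mul_eq_ip hv (mem_fiber _) (he _), smul_smul,
      Fin.prod_univ_castSucc]
    simp

variable [Nontrivial A]

lemma star_word_mul_segment (l : ℕ) (ν : Fin l → ι) :
    star (word v ν) * segment e 0 l = (∏ b : Fin l, ip (e b) (v (ν b))) • (1 : A) := by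
  have h := congrArg star (star_segment_mul_word hv he l ν)
  rw [star_mul, star_star, star_smul, star_one, star_prod] at h
  rw [h]
  congr 1
  exact Finset.prod_congr rfl fun b _ => ip_conj hv (mem_fiber _) (he _)

variable (he1 : ∀ k, ‖e k‖ = 1)
include he1

lemma star_segment_mul_self (k i : ℕ) : star (segment e k i) * segment e k i = 1 := by
  rw [star_segment_mul_segment hv he]
  simp [ip_self hv (he _), he1]

lemma norm_segment_le (k i : ℕ) : ‖segment e k i‖ ≤ 1 := by
  have h := CStarRing.norm_star_mul_self (x := segment e k i)
  rw [star_segment_mul_self hv he he1, CStarRing.norm_one] at h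
  nlinarith [norm_nonneg (segment e k i)]

omit he1 [Nontrivial A] in
-- After the common length collapses to a scalar, the rest of the longer segment starts with a fiber
-- vector, or ends with the adjoint of one, and the vacuum kills it.
lemma vacuum_segments {ω : StrongDual ℂ A} (h1 : ω 1 = 1)
    (hω : ∀ x ∈ fiber v, ∀ y, ω (x * y) = 0 ∧ ω (y * star x) = 0) (k l i j : ℕ) :
    ω (star (segment e k i) * segment e l j) =
      if i = j then ∏ a ∈ Finset.range i, ip (e (l + a)) (e (k + a)) else 0 := by
  have hhead : ∀ l n, ∃ y, segment e l (n + 1) = e l * y := by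
    intro l n
    rw [add_comm, segment_add]
    exact ⟨segment e (l + 1) n, by simp [segment]⟩
  rcases lt_trichotomy i j with h | h | h
  · obtain ⟨d, rfl⟩ := Nat.exists_eq_add_of_lt h
    rw [if_neg h.ne, add_assoc, segment_add, ← mul_assoc, star_segment_mul_segment hv he,
      smul_mul_assoc, one_mul, map_smul]
    obtain ⟨y, hy⟩ := hhead (l + i) d
    rw [hy, (hω _ (he _) _).1, smul_zero]
  · subst h
    rw [if_pos rfl, star_segment_mul_segment hv he, map_smul, h1, smul_eq_mul, mul_one]
  · obtain ⟨d, rfl⟩ := Nat.exists_eq_add_of_lt h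
    rw [if_neg h.ne', add_assoc, segment_add, star_mul, mul_assoc, star_segment_mul_segment hv he,
      mul_smul_comm, mul_one, map_smul]
    obtain ⟨y, hy⟩ := hhead (k + j) d
    rw [hy, star_mul, (hω _ (he _) _).2, smul_zero]

end Segments

/-! ### Consequences of the period: convergence of the products. -/

section Period

variable {ι A : Type u} [CStarAlgebra A] {v : ι → A} [Nontrivial A] (hv : IsIsometryFamily v)
include hv

/-- A quasi-triangle inequality: `⟨a,c⟩ - 1 = ⟨a-b, c-b⟩ + (⟨a,b⟩ - 1) + (⟨b,c⟩ - 1)`, and the first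
term is controlled by the others because `‖a-b‖² = 2(1 - Re⟨a,b⟩)`. -/
lemma norm_ip_sub_one_le {a b c : A} (ha : a ∈ fiber v) (hb : b ∈ fiber v) (hc : c ∈ fiber v)
    (ha1 : ‖a‖ = 1) (hb1 : ‖b‖ = 1) (hc1 : ‖c‖ = 1) :
    ‖ip a c - 1‖ ≤ 2 * (‖ip a b - 1‖ + ‖ip b c - 1‖) := by
  have e : ip a c - 1 = ip (a - b) (c - b) + (ip a b - 1) + (ip b c - 1) := by
    rw [ip_sub_left hv ha hb (Submodule.sub_mem _ hc hb), ip_sub_right hv ha hc hb,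
      ip_sub_right hv hb hc hb, ip_self hv hb, hb1]
    push_cast
    ring
  have h1 := norm_ip_le hv (Submodule.sub_mem _ ha hb) (Submodule.sub_mem _ hc hb)
  have h2 := norm_sub_sq_eq hv ha hb ha1 hb1
  have h3 := norm_sub_sq_eq hv hb hc hb1 hc1
  have h4 : ∀ z : ℂ, 1 - z.re ≤ ‖z - 1‖ := fun z => by
    have := Complex.abs_re_le_norm (z - 1)
    rw [Complex.sub_re, Complex.one_re] at this
    linarith [neg_le_abs (z.re - 1)]
  have h5 := h4 (ip a b)
  have h6 := h4 (ip b c)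
  rw [norm_sub_rev c b] at h1
  calc ‖ip a c - 1‖ ≤ ‖ip (a - b) (c - b)‖ + ‖ip a b - 1‖ + ‖ip b c - 1‖ := by
        rw [e]; exact norm_add₃_le
    _ ≤ _ := by nlinarith [sq_nonneg (‖a - b‖ - ‖b - c‖)]

/-- Rotating `a` and `c` by phases makes their inner products with `b` nonnegative, which reduces to
`norm_ip_sub_one_le`. -/
lemma one_sub_norm_ip_le {a b c : A} (ha : a ∈ fiber v) (hb : b ∈ fiber v) (hc : c ∈ fiber v)
    (ha1 : ‖a‖ = 1) (hb1 : ‖b‖ = 1) (hc1 : ‖c‖ = 1) :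
    1 - ‖ip a c‖ ≤ 2 * ((1 - ‖ip a b‖) + (1 - ‖ip b c‖)) := by
  obtain ⟨θ, hθ, hθ'⟩ := Complex.exists_norm_eq_mul_self (ip a b)
  obtain ⟨η, hη, hη'⟩ := Complex.exists_norm_eq_mul_self (ip c b)
  have ha' := Submodule.smul_mem _ θ ha
  have hc' := Submodule.smul_mem _ η hc
  have h := norm_ip_sub_one_le hv ha' hb hc' (by rw [norm_smul, hθ, ha1, one_mul]) hb1
    (by rw [norm_smul, hη, hc1, one_mul])
  have e1 : ip (θ • a) b = (‖ip a b‖ : ℂ) := by rw [ip_smul_left hv _ ha hb, ← hθ']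
  have e2 : ip b (η • c) = (‖ip b c‖ : ℂ) := by
    rw [← ip_conj hv hc' hb, ip_smul_left hv _ hc hb, ← hη', Complex.conj_ofReal,
      norm_ip_comm hv hc hb]
  have e3 : ‖ip (θ • a) (η • c)‖ = ‖ip a c‖ := by
    rw [ip_smul_left hv _ ha hc', ← ip_conj hv hc' ha, ip_smul_left hv _ hc ha, norm_mul,
      RCLike.norm_conj, norm_mul, hθ, hη, one_mul, one_mul, norm_ip_comm hv hc ha]
  have aux : ∀ x y : A, x ∈ fiber v → y ∈ fiber v → ‖x‖ = 1 → ‖y‖ = 1 →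
      ‖((‖ip x y‖ : ℝ) : ℂ) - 1‖ = 1 - ‖ip x y‖ := by
    intro x y hx hy hx1 hy1
    have := norm_ip_le hv hx hy
    rw [hx1, hy1, one_mul] at this
    rw [← Complex.ofReal_one, ← Complex.ofReal_sub, Complex.norm_real, Real.norm_eq_abs,
      abs_sub_comm, abs_of_nonneg (by linarith)]
  rw [e1, e2, aux a b ha hb ha1 hb1, aux b c hb hc hb1 hc1] at h
  have h7 := norm_sub_norm_le (1 : ℂ) (ip (θ • a) (η • c))
  rw [e3, norm_one, norm_sub_rev] at h7
  linarith

variable {e : ℕ → A} (he : ∀ k, e k ∈ fiber v) (he1 : ∀ k, ‖e k‖ = 1)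
include he he1

lemma norm_ip_le_one (k l : ℕ) : ‖ip (e k) (e l)‖ ≤ 1 := by
  simpa [he1] using norm_ip_le hv (he k) (he l)

lemma summable_one_sub_norm_ip_sub {q r : ℕ}
    (hq : Summable fun i => 1 - ‖ip (e i) (e (i + q))‖)
    (hr : Summable fun i => 1 - ‖ip (e i) (e (i + (q + r)))‖) :
    Summable fun i => 1 - ‖ip (e i) (e (i + r))‖ := by
  rw [← summable_nat_add_iff q]
  refine Summable.of_nonneg_of_le (fun i => sub_nonneg.2 (norm_ip_le_one hv he he1 _ _))
    (fun i => one_sub_norm_ip_le hv (he (i + q)) (he i) (he (i + q + r)) (he1 _) (he1 _) (he1 _))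
    ((Summable.add ?_ ?_).mul_left 2)
  · simpa only [norm_ip_comm hv (he (_ + q)) (he _)] using hq
  · simpa only [add_assoc] using hr

/-- The summable shifts are closed under subtraction, so subtracting the least positive one
repeatedly must end at 0. -/
lemma dvd_of_summable {p : ℕ} (hp : HasPeriod e p) (q : ℕ)
    (hq : Summable fun i => 1 - ‖ip (e i) (e (i + q))‖) : p ∣ q := by
  induction q using Nat.strong_induction_on with
  | _ q ih =>
    rcases Nat.eq_zero_or_pos q with h0 | h0
    · rw [h0]; exact dvd_zero p
    · have hle : p ≤ q := hp.2 ⟨h0, hq⟩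
      obtain ⟨r, rfl⟩ := Nat.exists_eq_add_of_le hle
      have hp0 : 0 < p := hp.1.1
      exact (Nat.dvd_add_right (dvd_refl p)).2 (ih r (by omega)
        (summable_one_sub_norm_ip_sub hv he he1 hp.1.2 hq))

/-- The sign condition enters here: it turns `1 - |⟨e_i, e_{i+p}⟩|` into `|⟨e_i, e_{i+p}⟩ - 1|`. The
quasi-triangle inequality then steps from `m p` to `(m+1) p`. -/
lemma summable_norm_ip_sub_one_mul {p : ℕ} (hp : HasPeriod e p)
    (hphase : ∀ i, 0 ≤ ip (e i) (e (i + p))) (m : ℕ) :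
    Summable fun i => ‖ip (e i) (e (i + m * p)) - 1‖ := by
  have hone : Summable fun i => ‖ip (e i) (e (i + p)) - 1‖ := by
    refine hp.1.2.congr fun i => ?_
    have h1 := Complex.nonneg_iff.1 (hphase i)
    have h2 : ip (e i) (e (i + p)) = (((ip (e i) (e (i + p))).re : ℝ) : ℂ) :=
      Complex.ext (by simp) (by simp [← h1.2])
    have h3 := norm_ip_le_one hv he he1 i (i + p)
    rw [h2, Complex.norm_real, Real.norm_of_nonneg h1.1] at h3
    rw [h2, Complex.norm_real, Real.norm_of_nonneg h1.1, ← Complex.ofReal_one,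
      ← Complex.ofReal_sub, Complex.norm_real, Real.norm_eq_abs, abs_sub_comm,
      abs_of_nonneg (by linarith)]
  induction m with
  | zero => simp [ip_self hv (he _), he1, summable_zero]
  | succ m ih =>
    refine Summable.of_nonneg_of_le (fun i => norm_nonneg _)
      (fun i => norm_ip_sub_one_le hv (he i) (he (i + m * p)) (he _) (he1 _) (he1 _) (he1 _))
      ((ih.add ?_).mul_left 2)
    have := (summable_nat_add_iff (m * p)).2 hone
    refine this.congr fun i => ?_
    rw [add_mul, one_mul, add_assoc]

lemma summable_norm_ip_sub_one {p : ℕ} (hp : HasPeriod e p)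
    (hphase : ∀ i, 0 ≤ ip (e i) (e (i + p))) {k l : ℕ} (h : (p : ℤ) ∣ (k : ℤ) - l) :
    Summable fun i => ‖ip (e (l + i)) (e (k + i)) - 1‖ := by
  have key : ∀ m l : ℕ, Summable fun i => ‖ip (e (l + i)) (e (l + m * p + i)) - 1‖ := by
    intro m l
    have := (summable_nat_add_iff l).2 (summable_norm_ip_sub_one_mul hv he he1 hp hphase m)
    refine this.congr fun i => ?_
    rw [add_comm i l, add_right_comm]
  rcases le_total l k with hlk | hlk
  · obtain ⟨d, rfl⟩ := Nat.exists_eq_add_of_le hlk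
    have : p ∣ d := by
      rw [← Int.natCast_dvd_natCast]
      simpa using h
    obtain ⟨m, rfl⟩ := this
    simpa only [mul_comm p m] using key m l
  · obtain ⟨d, rfl⟩ := Nat.exists_eq_add_of_le hlk
    have : p ∣ d := by
      rw [← Int.natCast_dvd_natCast]
      simpa using h
    obtain ⟨m, rfl⟩ := this
    refine (key m k).congr fun i => ?_
    rw [← ip_conj hv (he (k + i)) (he _), mul_comm p m, ← RCLike.norm_conj, map_sub, map_one]

lemma multipliable_ip {p : ℕ} (hp : HasPeriod e p)
    (hphase : ∀ i, 0 ≤ ip (e i) (e (i + p))) {k l : ℕ} (h : (p : ℤ) ∣ (k : ℤ) - l) :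
    Multipliable fun i => ip (e (l + i)) (e (k + i)) := by
  simpa using multipliable_one_add_of_summable (summable_norm_ip_sub_one hv he he1 hp hphase h)

/-- By `dvd_of_summable` the sum of `1 - |⟨e_{l+i}, e_{k+i}⟩|` diverges, and `t ≤ exp(-(1 - t))`
bounds the product by the exponential of minus the partial sums. -/
lemma tendsto_prod_ip_zero {p : ℕ} (hp : HasPeriod e p) {k l : ℕ}
    (h : ¬ (p : ℤ) ∣ (k : ℤ) - l) :
    Tendsto (fun n => ∏ i ∈ Finset.range n, ip (e (l + i)) (e (k + i))) atTop (𝓝 0) := by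
  have hns : ¬ Summable fun i => 1 - ‖ip (e (l + i)) (e (k + i))‖ := by
    intro hs
    rcases le_total l k with hlk | hlk
    · obtain ⟨d, rfl⟩ := Nat.exists_eq_add_of_le hlk
      refine h ?_
      have := dvd_of_summable hv he he1 hp d ((summable_nat_add_iff l).1 (hs.congr fun i => by
        rw [add_comm i l, add_right_comm]))
      rw [← Int.natCast_dvd_natCast] at this
      simpa using this
    · obtain ⟨d, rfl⟩ := Nat.exists_eq_add_of_le hlk
      refine h ?_
      have := dvd_of_summable hv he he1 hp d ((summable_nat_add_iff k).1 (hs.congr fun i => by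
        rw [add_comm i k, add_right_comm, norm_ip_comm hv (he _) (he _)]))
      rw [← Int.natCast_dvd_natCast] at this
      simpa using this
  rw [not_summable_iff_tendsto_nat_atTop_of_nonneg
    (fun i => sub_nonneg.2 (norm_ip_le_one hv he he1 _ _))] at hns
  rw [tendsto_zero_iff_norm_tendsto_zero]
  refine squeeze_zero (fun n => norm_nonneg _) (fun n => ?_)
    (Real.tendsto_exp_neg_atTop_nhds_zero.comp hns)
  rw [norm_prod, Function.comp, ← Finset.sum_neg_distrib, Real.exp_sum]
  refine Finset.prod_le_prod (fun _ _ => norm_nonneg _) fun i _ => ?_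
  have := Real.add_one_le_exp (-(1 - ‖ip (e (l + i)) (e (k + i))‖))
  linarith

lemma tendsto_prod_ip {p : ℕ} (hp : HasPeriod e p)
    (hphase : ∀ i, 0 ≤ ip (e i) (e (i + p))) {k l : ℕ} (h : (p : ℤ) ∣ (k : ℤ) - l) :
    Tendsto (fun n => ∏ i ∈ Finset.range n, ip (e (l + i)) (e (k + i))) atTop
      (𝓝 (∏' i, ip (e (l + i)) (e (k + i)))) :=
  (multipliable_ip hv he he1 hp hphase h).hasProd.tendsto_prod_nat

/-- The partial products of the inner products converge to one uniformly along the tails. -/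
lemma exists_norm_prod_ip_sub_one_le {p : ℕ} (hp : HasPeriod e p)
    (hphase : ∀ i, 0 ≤ ip (e i) (e (i + p))) {k l : ℕ} (h : (p : ℤ) ∣ (k : ℤ) - l) {ε : ℝ}
    (hε : 0 < ε) : ∃ N, ∀ n ≥ N, ∀ i,
      ‖∏ j ∈ Finset.range i, ip (e (l + n + j)) (e (k + n + j)) - 1‖ ≤ ε := by
  obtain ⟨s, hs⟩ := prod_vanishing_of_summable_norm
    (summable_norm_ip_sub_one hv he he1 hp hphase h) hε
  -- Past the largest element of `s`, every block of indices is disjoint from `s`.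
  refine ⟨s.sup id + 1, fun n hn i => ?_⟩
  have hd : Disjoint ((Finset.range i).map (addLeftEmbedding n)) s := by
    rw [Finset.disjoint_left]
    intro x hx hxs
    obtain ⟨j, -, rfl⟩ := Finset.mem_map.1 hx
    have := Finset.le_sup (f := id) hxs
    simp only [addLeftEmbedding_apply, id] at this
    omega
  have := (hs _ hd).le
  rw [Finset.prod_map] at this
  simpa [add_assoc] using this

end Period

/-! ### Averages along diagonals. -/

section Averages

lemma sum_ite_sub_eq (n j : ℕ) (m : ℤ) (x : ℂ) :
    (∑ i ∈ Finset.range n, if (i : ℤ) - j = m then x else 0) =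
      if 0 ≤ (j : ℤ) + m ∧ (j : ℤ) + m < n then x else 0 := by
  split_ifs with h
  · rw [Finset.sum_eq_single (((j : ℤ) + m).toNat)]
    · rw [if_pos (by omega)]
    · intro b _ hb
      rw [if_neg (by omega)]
    · intro hb
      rw [Finset.mem_range] at hb
      omega
  · refine Finset.sum_eq_zero fun i hi => if_neg ?_
    rw [Finset.mem_range] at hi
    omega

lemma card_filter_shift_le (n : ℕ) (m : ℤ) :
    ((Finset.range n).filter fun j : ℕ => ¬ (0 ≤ (j : ℤ) + m ∧ (j : ℤ) + m < n)).card ≤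
      m.natAbs := by
  rcases le_total 0 m with hm | hm
  · refine (Finset.card_le_card (t := Finset.Ico (n - m.natAbs) n) fun j hj => ?_).trans ?_
    · simp only [Finset.mem_filter, Finset.mem_range, Finset.mem_Ico] at hj ⊢
      omega
    · rw [Nat.card_Ico]; omega
  · refine (Finset.card_le_card (t := Finset.range m.natAbs) fun j hj => ?_).trans ?_
    · simp only [Finset.mem_filter, Finset.mem_range] at hj ⊢
      omega
    · rw [Finset.card_range]

/-- Averages along a diagonal of a large square. -/
lemma tendsto_diagonal_average (m : ℤ) (x : ℕ → ℕ → ℂ) (L : ℂ)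
    (hx : ∀ ε > 0, ∃ N, ∀ n ≥ N, ∀ j, ‖x n j - L‖ ≤ ε) :
    Tendsto (fun n : ℕ => (n : ℂ)⁻¹ * ∑ j ∈ Finset.range n, ∑ i ∈ Finset.range n,
      if (i : ℤ) - j = m then x n j else 0) atTop (𝓝 L) := by
  rw [Metric.tendsto_atTop]
  intro ε hε
  obtain ⟨N, hN⟩ := hx (ε / 4) (by positivity)
  -- At most `|m|` rows miss the diagonal, each costing `‖L‖`; for `n > M` they contribute less than
  -- `ε / 4` to the average.
  obtain ⟨M, hM⟩ := exists_nat_gt (4 * (m.natAbs * ‖L‖) / ε)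
  refine ⟨max N (M + 1), fun n hn => ?_⟩
  have hnN : N ≤ n := le_of_max_le_left hn
  have hnM : M + 1 ≤ n := le_of_max_le_right hn
  have hn0 : (0 : ℝ) < n := by exact_mod_cast (by omega : 0 < n)
  have hn0' : (n : ℂ) ≠ 0 := by exact_mod_cast (by omega : n ≠ 0)
  simp only [sum_ite_sub_eq]
  let P : ℕ → Prop := fun j => 0 ≤ (j : ℤ) + m ∧ (j : ℤ) + m < n
  have e : (n : ℂ)⁻¹ * (∑ j ∈ Finset.range n, if P j then x n j else 0) - L =
      (n : ℂ)⁻¹ * ∑ j ∈ Finset.range n, ((if P j then x n j else 0) - L) := by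
    rw [Finset.sum_sub_distrib, mul_sub]
    simp [hn0']
  have hb : ∀ j ∈ Finset.range n, ‖(if P j then x n j else 0) - L‖ ≤
      ε / 4 + if ¬ P j then ‖L‖ else 0 := by
    intro j _
    by_cases h : P j
    · simpa [h] using hN n hnN j
    · simp [h]; positivity
  have hs : ‖∑ j ∈ Finset.range n, ((if P j then x n j else 0) - L)‖ ≤
      n * (ε / 4) + m.natAbs * ‖L‖ := by
    refine (norm_sum_le_of_le _ hb).trans ?_
    rw [Finset.sum_add_distrib, ← Finset.sum_filter]
    simp only [Finset.sum_const, Finset.card_range, nsmul_eq_mul]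
    have := card_filter_shift_le n m
    gcongr
  have hMn : 4 * (m.natAbs * ‖L‖) / ε < n := hM.trans_le (by exact_mod_cast (by omega : M ≤ n))
  rw [div_lt_iff₀ hε] at hMn
  change dist ((n : ℂ)⁻¹ * (∑ j ∈ Finset.range n, if P j then x n j else 0)) L < ε
  rw [dist_eq_norm, e, norm_mul, norm_inv, Complex.norm_natCast]
  calc (n : ℝ)⁻¹ * _ ≤ (n : ℝ)⁻¹ * (n * (ε / 4) + m.natAbs * ‖L‖) := by gcongr
    _ < ε := by
      rw [inv_mul_lt_iff₀ hn0]
      nlinarith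

end Averages

/-! ### Herglotz' theorem and uniqueness of Fourier coefficients. -/

section Herglotz

/-- The Fejér measures of a positive definite sequence, on the roots of unity. -/
lemma exists_fejer_measure (c : ℤ → ℂ) (hc0 : c 0 = 1)
    (hc : ∀ (n : ℕ) (a : ℕ → ℂ), 0 ≤ ∑ j ∈ Finset.range n, ∑ i ∈ Finset.range n,
      (starRingEnd ℂ) (a j) * a i * c ((i : ℤ) - j)) {R : ℕ} (hR : 0 < R) :
    ∃ σ : ProbabilityMeasure Circle, ∀ m : ℤ, m.natAbs ≤ R → fourierCoeff σ m =
      (R : ℂ)⁻¹ * ∑ j ∈ Finset.range R, ∑ i ∈ Finset.range R,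
        if (i : ℤ) - j = m then c m else 0 := by
  have hR' : (R : ℂ) ≠ 0 := by exact_mod_cast hR.ne'
  -- For `i, j < R` and `|m| ≤ R` one has `|i - j - m| < 2R`, so orthogonality of the `N`-th roots
  -- of unity selects exactly `i - j = m`. Finitely many point masses thus replace the Fejér
  -- density.
  let N := 2 * R
  let z : ℕ → Circle := fun s => Circle.exp (2 * Real.pi / N) ^ s
  let f : ℕ → ℂ := fun s => ∑ j ∈ Finset.range R, ∑ i ∈ Finset.range R,
    (starRingEnd ℂ) ((z s : ℂ) ^ j) * (z s : ℂ) ^ i * c ((i : ℤ) - j)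
  have hf : ∀ s, 0 ≤ f s := fun s => hc R fun j => (z s : ℂ) ^ j
  have hf' : ∀ s, f s = ∑ j ∈ Finset.range R, ∑ i ∈ Finset.range R,
      (z s : ℂ) ^ ((i : ℤ) - j) * c ((i : ℤ) - j) := by
    intro s
    refine Finset.sum_congr rfl fun j _ => Finset.sum_congr rfl fun i _ => ?_
    rw [zpow_sub₀ (Circle.coe_ne_zero _), zpow_natCast, zpow_natCast, map_pow,
      ← Circle.coe_inv_eq_conj, Circle.coe_inv, inv_pow]
    ring
  let w : ℕ → ℝ := fun s => (N : ℝ)⁻¹ * (R : ℝ)⁻¹ * (f s).re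
  have hw : ∀ s, 0 ≤ w s := fun s => by
    have := (Complex.nonneg_iff.1 (hf s)).1
    positivity
  have hwf : ∀ s, (w s : ℂ) = (N : ℂ)⁻¹ * (R : ℂ)⁻¹ * f s := by
    intro s
    have : f s = ((f s).re : ℂ) :=
      Complex.ext (by simp) (by simp [← (Complex.nonneg_iff.1 (hf s)).2])
    rw [this]
    simp only [w]
    push_cast
    rfl
  have hsum : ∀ m : ℤ, m.natAbs ≤ R → ∑ s ∈ Finset.range N, (w s : ℂ) * (z s : ℂ) ^ (-m) =
      (R : ℂ)⁻¹ * ∑ j ∈ Finset.range R, ∑ i ∈ Finset.range R,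
        if (i : ℤ) - j = m then c m else 0 := by
    intro m hm
    have e1 : ∀ s, (w s : ℂ) * (z s : ℂ) ^ (-m) = (R : ℂ)⁻¹ * ∑ j ∈ Finset.range R,
        ∑ i ∈ Finset.range R, c ((i : ℤ) - j) * ((N : ℂ)⁻¹ * (z s : ℂ) ^ ((i : ℤ) - j - m)) := by
      intro s
      rw [hwf, hf', mul_comm (N : ℂ)⁻¹, mul_assoc, mul_assoc]
      congr 1
      rw [Finset.sum_mul, Finset.mul_sum]
      refine Finset.sum_congr rfl fun j _ => ?_
      rw [Finset.sum_mul, Finset.mul_sum]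
      refine Finset.sum_congr rfl fun i _ => ?_
      rw [sub_eq_add_neg ((i : ℤ) - j) m, zpow_add₀ (Circle.coe_ne_zero _)]
      ring
    rw [Finset.sum_congr rfl fun s _ => e1 s, ← Finset.mul_sum, Finset.sum_comm]
    congr 1
    refine Finset.sum_congr rfl fun j hj => ?_
    rw [Finset.sum_comm]
    refine Finset.sum_congr rfl fun i hi => ?_
    rw [Finset.mem_range] at hi hj
    rw [← Finset.mul_sum, ← Finset.mul_sum, sum_rootsOfUnity_zpow N _ (by omega)]
    by_cases h : (i : ℤ) - j = m
    · rw [if_pos h, if_pos (by omega), h, mul_one]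
    · rw [if_neg h, if_neg (by omega), mul_zero]
  let μ : Measure Circle := ∑ s ∈ Finset.range N, ENNReal.ofReal (w s) • Measure.dirac (z s)
  have hμ : IsProbabilityMeasure μ := by
    constructor
    have h1 := hsum 0 (by simp)
    simp only [neg_zero, zpow_zero, mul_one, sum_ite_sub_eq, hc0] at h1
    have h2 : ∑ s ∈ Finset.range N, w s = 1 := by
      apply Complex.ofReal_injective
      push_cast
      rw [h1, Finset.sum_congr rfl (g := fun _ => 1) fun j hj => if_pos (by
        rw [Finset.mem_range] at hj; omega)]
      simp [hR']
    simp only [μ, Measure.coe_finsetSum, Finset.sum_apply, Measure.smul_apply, smul_eq_mul,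
      measure_univ, mul_one]
    rw [← ENNReal.ofReal_sum_of_nonneg fun s _ => hw s, h2, ENNReal.ofReal_one]
  refine ⟨⟨μ, hμ⟩, fun m hm => ?_⟩
  rw [← hsum m hm]
  change ∫ z : Circle, (z : ℂ) ^ (-m) ∂μ = _
  rw [integral_finsetSum_measure]
  · refine Finset.sum_congr rfl fun s _ => ?_
    rw [integral_smul_measure, integral_dirac, ENNReal.toReal_ofReal (hw s), Complex.real_smul]
  · intro s _
    exact (integrable_dirac (by simp)).smul_measure ENNReal.ofReal_ne_top

lemma continuous_circle_zpow (m : ℤ) : Continuous fun z : Circle => (z : ℂ) ^ m :=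
  continuous_iff_continuousAt.2 fun z =>
    (continuousAt_zpow₀ _ m (Or.inl (Circle.coe_ne_zero z))).comp
      (by fun_prop : Continuous fun z : Circle => (z : ℂ)).continuousAt

/-- The monomials on the circle as bounded continuous functions. -/
noncomputable def circleMonomial (m : ℤ) : BoundedContinuousFunction Circle ℂ :=
  BoundedContinuousFunction.mkOfCompact ⟨fun z => (z : ℂ) ^ m, continuous_circle_zpow m⟩

/-- Herglotz' theorem. -/
theorem exists_fourierCoeff_eq (c : ℤ → ℂ) (hc0 : c 0 = 1)
    (hc : ∀ (n : ℕ) (a : ℕ → ℂ), 0 ≤ ∑ j ∈ Finset.range n, ∑ i ∈ Finset.range n,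
      (starRingEnd ℂ) (a j) * a i * c ((i : ℤ) - j)) :
    ∃ σ : ProbabilityMeasure Circle, ∀ m, fourierCoeff σ m = c m := by
  choose σ hσ using fun R : ℕ => exists_fejer_measure c hc0 hc (Nat.succ_pos R)
  let U : Ultrafilter (ProbabilityMeasure Circle) := (hyperfilter ℕ).map σ
  obtain ⟨τ, -, hτ⟩ := isCompact_univ.ultrafilter_le_nhds U (by simp)
  have hτ' : Tendsto σ (hyperfilter ℕ : Filter ℕ) (𝓝 τ) := hτ
  refine ⟨τ, fun m => ?_⟩
  have h1 : Tendsto (fun R => fourierCoeff (σ R) m) (hyperfilter ℕ : Filter ℕ)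
      (𝓝 (fourierCoeff τ m)) :=
    (ProbabilityMeasure.tendsto_iff_forall_integral_rclike_tendsto ℂ).1 hτ' (circleMonomial (-m))
  have hle : (hyperfilter ℕ : Filter ℕ) ≤ atTop := by
    rw [← Nat.cofinite_eq_atTop]; exact hyperfilter_le_cofinite
  -- The Fejér weights along a fixed diagonal tend to 1.
  have h2 := (tendsto_diagonal_average m (fun _ _ => c m) (c m)
    (fun ε hε => ⟨0, fun _ _ _ => by simpa using hε.le⟩)).comp (tendsto_add_atTop_nat 1)
  refine tendsto_nhds_unique h1 ((h2.mono_left hle).congr' ?_)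
  refine hle ?_
  filter_upwards [eventually_ge_atTop m.natAbs] with R hR
  rw [hσ R m (by omega)]
  rfl

/-- Probability measures on the circle are determined by their Fourier coefficients. -/
theorem fourierCoeff_injective {σ τ : ProbabilityMeasure Circle}
    (h : ∀ m, fourierCoeff σ m = fourierCoeff τ m) : σ = τ := by
  let W : Submodule ℂ (BoundedContinuousFunction Circle ℂ) :=
    Submodule.span ℂ (Set.range circleMonomial)
  have hmul : ∀ m n, circleMonomial m * circleMonomial n = circleMonomial (m + n) := by
    intro m n
    ext z
    exact (zpow_add₀ (Circle.coe_ne_zero z) m n).symm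
  have hone : circleMonomial 0 = 1 := by
    ext z
    exact zpow_zero _
  have hstar : ∀ m, star (circleMonomial m) = circleMonomial (-m) := by
    intro m
    ext z
    change (starRingEnd ℂ) ((z : ℂ) ^ m) = (z : ℂ) ^ (-m)
    rw [map_zpow₀, ← Circle.coe_inv_eq_conj, Circle.coe_inv, inv_zpow, zpow_neg]
  let S : StarSubalgebra ℂ (BoundedContinuousFunction Circle ℂ) :=
    { carrier := W
      mul_mem' := fun {a b} ha hb => by
        have h1 := Submodule.mul_mem_mul ha hb
        rw [Submodule.span_mul_span] at h1
        refine Submodule.span_mono ?_ h1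
        rintro _ ⟨_, ⟨m, rfl⟩, _, ⟨n, rfl⟩, rfl⟩
        exact ⟨m + n, (hmul m n).symm⟩
      one_mem' := Submodule.subset_span ⟨0, hone⟩
      add_mem' := W.add_mem
      zero_mem' := W.zero_mem
      algebraMap_mem' := fun r => by
        rw [Algebra.algebraMap_eq_smul_one, ← hone]
        exact W.smul_mem r (Submodule.subset_span ⟨0, rfl⟩)
      star_mem' := fun {a} ha => by
        change star a ∈ W
        induction ha using Submodule.span_induction with
        | mem y hy =>
          obtain ⟨m, rfl⟩ := hy
          rw [hstar]
          exact Submodule.subset_span ⟨-m, rfl⟩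
        | zero => simp
        | add a b _ _ ha hb => rw [star_add]; exact W.add_mem ha hb
        | smul c a _ ha => rw [star_smul]; exact W.smul_mem _ ha }
  have hσ : IsProbabilityMeasure σ.1 := σ.2
  have hτ : IsProbabilityMeasure τ.1 := τ.2
  apply Subtype.ext
  -- The trigonometric polynomials form a point-separating ⋆-algebra, and such an algebra determines
  -- a measure.
  refine ext_of_forall_mem_subalgebra_integral_eq_of_polish (A := S) (𝕜 := ℂ) ?_ fun g hg => ?_
  · intro x y hxy
    refine ⟨_, ⟨_, ⟨circleMonomial 1, Submodule.subset_span ⟨1, rfl⟩, rfl⟩, rfl⟩, ?_⟩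
    change (x : ℂ) ^ (1 : ℤ) ≠ (y : ℂ) ^ (1 : ℤ)
    rw [zpow_one, zpow_one]
    exact fun h => hxy (Circle.ext h)
  · change g ∈ W at hg
    induction hg using Submodule.span_induction with
    | mem y hy =>
      obtain ⟨m, rfl⟩ := hy
      simpa [fourierCoeff, circleMonomial] using h (-m)
    | zero => simp
    | add a b _ _ ha hb =>
      simp only [BoundedContinuousFunction.coe_add, Pi.add_apply]
      rw [integral_add (a.integrable _) (b.integrable _),
        integral_add (a.integrable _) (b.integrable _), ha, hb]
    | smul c a _ ha =>
      simp only [BoundedContinuousFunction.coe_smul]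
      rw [integral_smul, integral_smul, ha]

end Herglotz

/-! ### Construction of an extension from a measure. -/

section Existence

lemma fourierCoeff_zero (σ : ProbabilityMeasure Circle) : fourierCoeff σ 0 = 1 := by
  change ∫ z : Circle, (z : ℂ) ^ (-(0 : ℤ)) ∂(σ : Measure Circle) = 1
  simp

/-- Schur product positivity: the sum is the `σ`-average over `z` of the quadratic form of `M` at
the vector `(z^j)`. -/
lemma sum_fourierCoeff_nonneg (σ : ProbabilityMeasure Circle) (n : ℕ) (M : ℕ → ℕ → ℂ)
    (hM : ∀ a : ℕ → ℂ, 0 ≤ ∑ j ∈ Finset.range n, ∑ i ∈ Finset.range n,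
      (starRingEnd ℂ) (a i) * a j * M i j) :
    0 ≤ ∑ j ∈ Finset.range n, ∑ i ∈ Finset.range n, fourierCoeff σ ((i : ℤ) - j) * M i j := by
  let h : Circle → ℂ := fun z => ∑ j ∈ Finset.range n, ∑ i ∈ Finset.range n,
    (z : ℂ) ^ (-((i : ℤ) - j)) * M i j
  have hint : ∀ m : ℤ, Integrable (fun z : Circle => (z : ℂ) ^ m) (σ : Measure Circle) := fun m =>
    (circleMonomial m).integrable _
  have e1 : ∑ j ∈ Finset.range n, ∑ i ∈ Finset.range n, fourierCoeff σ ((i : ℤ) - j) * M i j =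
      ∫ z, h z ∂(σ : Measure Circle) := by
    simp only [h]
    rw [integral_finsetSum _ fun j _ => integrable_finsetSum _ fun i _ =>
      (hint _).mul_const _]
    refine Finset.sum_congr rfl fun j _ => ?_
    rw [integral_finsetSum _ fun i _ => (hint _).mul_const _]
    refine Finset.sum_congr rfl fun i _ => ?_
    rw [integral_mul_const]
    rfl
  have hpos : ∀ z, 0 ≤ h z := by
    intro z
    refine (hM fun j => (z : ℂ) ^ j).trans_eq ?_
    refine Finset.sum_congr rfl fun j _ => Finset.sum_congr rfl fun i _ => ?_
    rw [neg_sub, zpow_sub₀ (Circle.coe_ne_zero _), zpow_natCast, zpow_natCast, map_pow,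
      ← Circle.coe_inv_eq_conj, Circle.coe_inv, inv_pow, div_eq_inv_mul]
  have hre : h = fun z => (((h z).re : ℝ) : ℂ) := by
    ext z
    exact Complex.ext (by simp) (by simp [← (Complex.nonneg_iff.1 (hpos z)).2])
  rw [e1, hre, integral_complex_ofReal]
  exact Complex.zero_le_real.2 (integral_nonneg fun z => (Complex.nonneg_iff.1 (hpos z)).1)

variable {ι A : Type u} [CStarAlgebra A] {v : ι → A}

/-- The projections `E_N E_N⋆` with `E_N = e_0 ⋯ e_{N-1}`. -/
noncomputable def segmentProj (e : ℕ → A) (N : ℕ) : A :=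
  segment e 0 N * star (segment e 0 N)

/-- The functionals whose limits are the extensions of the product state. -/
noncomputable def approxState (e : ℕ → A) (p : ℕ) (σ : ProbabilityMeasure Circle)
    (ω : StrongDual ℂ A) (n : ℕ) : StrongDual ℂ A :=
  (n : ℂ)⁻¹ • ∑ j ∈ Finset.range n, ∑ i ∈ Finset.range n, fourierCoeff σ ((i : ℤ) - j) •
    (ω.comp (((ContinuousLinearMap.mul ℂ A) (star (segment e 0 (n + i * p)))).comp
      ((ContinuousLinearMap.mul ℂ A).flip (segment e 0 (n + j * p)))))

lemma approxState_apply (e : ℕ → A) (p : ℕ) (σ : ProbabilityMeasure Circle)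
    (ω : StrongDual ℂ A) (n : ℕ) (a : A) :
    approxState e p σ ω n a = (n : ℂ)⁻¹ * ∑ j ∈ Finset.range n, ∑ i ∈ Finset.range n,
      fourierCoeff σ ((i : ℤ) - j) *
        ω (star (segment e 0 (n + i * p)) * (a * segment e 0 (n + j * p))) := by
  simp [approxState]

variable [Nontrivial A] (hv : IsIsometryFamily v) {e : ℕ → A} (he : ∀ k, e k ∈ fiber v) (he1 : ∀ k, ‖e k‖ = 1)
include hv he

lemma vacuum_segment_word {ω : StrongDual ℂ A} (h1 : ω 1 = 1)
    (hω : ∀ x ∈ fiber v, ∀ y, ω (x * y) = 0 ∧ ω (y * star x) = 0) {k l : ℕ} (μ : Fin k → ι)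
    (ν : Fin l → ι) (i j : ℕ) :
    ω (star (segment e 0 (k + i)) * (word v μ * star (word v ν) * segment e 0 (l + j))) =
      (∏ a : Fin k, ip (v (μ a)) (e a)) * (∏ b : Fin l, ip (e b) (v (ν b))) *
        if i = j then ∏ a ∈ Finset.range i, ip (e (l + a)) (e (k + a)) else 0 := by
  have e1 : star (segment e 0 (k + i)) * (word v μ * star (word v ν) * segment e 0 (l + j)) =
      star (segment e k i) * ((star (segment e 0 k) * word v μ) *
        (star (word v ν) * segment e 0 l)) * segment e l j := by
    rw [segment_add, segment_add, star_mul, zero_add, zero_add]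
    simp only [mul_assoc]
  rw [e1, star_segment_mul_word hv he, star_word_mul_segment hv he, smul_mul_smul_comm, one_mul,
    mul_smul_comm, mul_one, smul_mul_assoc, map_smul, vacuum_segments hv he h1 hω, smul_eq_mul]

include he1

lemma segmentProj_mul_segment (N i : ℕ) :
    segmentProj e N * segment e 0 (N + i) = segment e 0 (N + i) := by
  rw [segmentProj, segment_add, mul_assoc, ← mul_assoc (star _), star_segment_mul_self hv he he1,
    one_mul]

/-- Positivity is the Schur product of the Toeplitz matrix of `σ` with the Gram matrix of the `a
E_{n+jp}`. For `a = 1` the Gram matrix is the identity, the lengths `n + j p` being distinct. -/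
lemma approxState_mem {p : ℕ} (hp : 0 < p) (σ : ProbabilityMeasure Circle)
    {ω : StrongDual ℂ A} (hωs : ω ∈ stateSpace A)
    (hω : ∀ x ∈ fiber v, ∀ y, ω (x * y) = 0 ∧ ω (y * star x) = 0) {n : ℕ} (hn : 0 < n) :
    approxState e p σ ω n ∈ stateSpace A := by
  have hn' : (n : ℂ) ≠ 0 := by exact_mod_cast hn.ne'
  constructor
  · intro a
    rw [approxState_apply]
    refine mul_nonneg ?_ (sum_fourierCoeff_nonneg σ n _ fun c => ?_)
    · rw [← Complex.ofReal_natCast, ← Complex.ofReal_inv]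
      exact Complex.zero_le_real.2 (by positivity)
    · refine (hωs.1 (∑ j ∈ Finset.range n, c j • (a * segment e 0 (n + j * p)))).trans_eq ?_
      rw [Finset.mul_sum, map_sum]
      refine Finset.sum_congr rfl fun j _ => ?_
      rw [star_sum, Finset.sum_mul, map_sum]
      refine Finset.sum_congr rfl fun i _ => ?_
      rw [star_smul, smul_mul_smul_comm, map_smul, star_mul, smul_eq_mul]
      simp only [mul_assoc]
      rfl
  · rw [approxState_apply]
    have h : ∀ i j, ω (star (segment e 0 (n + i * p)) * (1 * segment e 0 (n + j * p))) =
        if i = j then 1 else 0 := by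
      intro i j
      rw [one_mul, vacuum_segments hv he hωs.2 hω]
      by_cases hij : i = j
      · subst hij
        simp [ip_self hv (he _), he1]
      · rw [if_neg hij, if_neg]
        intro h
        exact hij (Nat.eq_of_mul_eq_mul_right hp (Nat.add_left_cancel h))
    simp only [h, mul_ite, mul_one, mul_zero]
    rw [Finset.sum_congr rfl (g := fun _ => (1 : ℂ)) fun j hj => by
      rw [Finset.sum_ite_eq' (Finset.range n) j, if_pos hj, sub_self, fourierCoeff_zero]]
    simp [hn']

/-- Only terms with `(i - j) p = k - l` survive: no term if `p ∤ k - l`, otherwise one diagonal.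
There the partial products have length at least `n - l`, so they converge uniformly in `j`. -/
lemma tendsto_approxState {p : ℕ} (hp : HasPeriod e p)
    (hphase : ∀ i, 0 ≤ ip (e i) (e (i + p))) (σ : ProbabilityMeasure Circle)
    {ω : StrongDual ℂ A} (h1 : ω 1 = 1)
    (hω : ∀ x ∈ fiber v, ∀ y, ω (x * y) = 0 ∧ ω (y * star x) = 0) {k l : ℕ} (μ : Fin k → ι)
    (ν : Fin l → ι) :
    Tendsto (fun n => approxState e p σ ω n (word v μ * star (word v ν))) atTop
      (𝓝 (coeff e p σ k l * (∏ a : Fin k, ip (v (μ a)) (e a)) *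
        ∏ b : Fin l, ip (e b) (v (ν b)))) := by
  have hp0 := hp.1.1
  set C := (∏ a : Fin k, ip (v (μ a)) (e a)) * ∏ b : Fin l, ip (e b) (v (ν b)) with hC
  -- The bound on `n` makes the subtraction `n + j * p - l` a genuine one.
  have hval : ∀ n ≥ k + l, ∀ i j : ℕ, ω (star (segment e 0 (n + i * p)) *
      (word v μ * star (word v ν) * segment e 0 (n + j * p))) =
      C * if ((i : ℤ) - j) * p = (k : ℤ) - l then
        ∏ a ∈ Finset.range (n + j * p - l), ip (e (l + a)) (e (k + a)) else 0 := by
    intro n hn i j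
    obtain ⟨s, hs⟩ := Nat.exists_eq_add_of_le (show k ≤ n + i * p by omega)
    obtain ⟨t, ht⟩ := Nat.exists_eq_add_of_le (show l ≤ n + j * p by omega)
    have hs' : (n : ℤ) + i * p = k + s := by exact_mod_cast hs
    have ht' : (n : ℤ) + j * p = l + t := by exact_mod_cast ht
    have hiff : s = t ↔ ((i : ℤ) - j) * p = (k : ℤ) - l := by
      rw [sub_mul]
      omega
    rw [hs, ht, vacuum_segment_word hv he h1 hω, Nat.add_sub_cancel_left]
    simp only [← hiff]
    congr 1
    split_ifs with h
    · rw [h]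
    · rfl
  rw [mul_assoc, ← hC]
  clear_value C
  by_cases hd : (p : ℤ) ∣ (k : ℤ) - l
  · obtain ⟨m, hm⟩ := hd
    have hp' : (p : ℤ) ≠ 0 := by omega
    have hlim := tendsto_diagonal_average m
      (fun n j => ∏ a ∈ Finset.range (n + j * p - l), ip (e (l + a)) (e (k + a)))
      (∏' i, ip (e (l + i)) (e (k + i))) (fun ε hε => by
        obtain ⟨N, hN⟩ := Metric.tendsto_atTop.1
          (tendsto_prod_ip hv he he1 hp hphase (k := k) (l := l) ⟨m, hm⟩) ε hε
        refine ⟨N + l, fun n hn j => ?_⟩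
        rw [← dist_eq_norm]
        exact (hN _ (by omega)).le)
    have hcoeff : coeff e p σ k l = fourierCoeff σ m * ∏' i, ip (e (l + i)) (e (k + i)) := by
      rw [coeff, if_pos ⟨m, hm⟩, hm, Int.mul_ediv_cancel_left _ hp']
    rw [hcoeff]
    have hlim2 := (hlim.const_mul (fourierCoeff σ m)).mul_const C
    refine hlim2.congr' ?_
    filter_upwards [eventually_ge_atTop (k + l)] with n hn
    have hiff : ∀ i j : ℕ, ((i : ℤ) - j) * p = p * m ↔ (i : ℤ) - j = m := fun i j => by
      rw [mul_comm, mul_right_inj' hp']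
    rw [approxState_apply, mul_left_comm, mul_assoc]
    congr 1
    rw [mul_right_comm, Finset.mul_sum]
    refine Finset.sum_congr rfl fun j _ => ?_
    rw [Finset.mul_sum]
    refine Finset.sum_congr rfl fun i _ => ?_
    rw [hval n hn, hm]
    simp only [hiff]
    split_ifs with h
    · rw [h]; ring
    · simp
  · have hcoeff : coeff e p σ k l = 0 := by rw [coeff, if_neg hd]
    rw [hcoeff, zero_mul]
    refine tendsto_const_nhds.congr' ?_
    filter_upwards [eventually_ge_atTop (k + l)] with n hn
    rw [approxState_apply, Finset.sum_eq_zero, mul_zero]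
    intro j _
    refine Finset.sum_eq_zero fun i _ => ?_
    rw [hval n hn, if_neg, mul_zero, mul_zero]
    intro h
    exact hd ⟨(i : ℤ) - j, by rw [← h, mul_comm]⟩

/-- Every `E_{n+jp}` begins with `E_N` when `N ≤ n`, so `P_N` fixes it. In the limit the extension
takes the value 1 on every `P_N`. -/
lemma approxState_segmentProj (p : ℕ) (σ : ProbabilityMeasure Circle)
    (ω : StrongDual ℂ A) {n N : ℕ} (hn : N ≤ n) :
    approxState e p σ ω n (segmentProj e N) = approxState e p σ ω n 1 := by
  rw [approxState_apply, approxState_apply]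
  congr 1
  refine Finset.sum_congr rfl fun j _ => Finset.sum_congr rfl fun i _ => ?_
  congr 2
  obtain ⟨t, ht⟩ := Nat.exists_eq_add_of_le (show N ≤ n + j * p by omega)
  rw [ht, one_mul, segmentProj_mul_segment hv he he1]

end Existence

section Extension

variable {ι A : Type u} [CStarAlgebra A] {v : ι → A} [Nontrivial A]

/-- Existence of the extensions of the product state. -/
theorem IsToeplitzCuntz.exists_extension (hv : IsToeplitzCuntz v)
    {e : ℕ → A} (he : ∀ k, e k ∈ fiber v) (he1 : ∀ k, ‖e k‖ = 1) {p : ℕ} (hp : HasPeriod e p)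
    (hphase : ∀ i, 0 ≤ ip (e i) (e (i + p))) (σ : ProbabilityMeasure Circle) :
    ∃ ψ ∈ stateSpace A, (∀ N, ψ (segmentProj e N) = 1) ∧
      ∀ (k l : ℕ) (μ : Fin k → ι) (ν : Fin l → ι), ψ (word v μ * star (word v ν)) =
        coeff e p σ k l * (∏ a : Fin k, ip (v (μ a)) (e a)) * ∏ b : Fin l, ip (e b) (v (ν b)) := by
  obtain ⟨ω, hωs, hω⟩ := hv.exists_vacuum
  -- The index is shifted by one because the functional for `n = 0` is zero.
  have hmem := fun n => approxState_mem hv.family he he1 hp.1.1 σ hωs hω (Nat.succ_pos n)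
  obtain ⟨ψ, hψ, hlim⟩ := exists_state_of_tendsto _ hmem
  refine ⟨ψ, hψ, fun N => hlim _ _ ?_, fun k l μ ν => hlim _ _ ?_⟩
  · refine tendsto_const_nhds.congr' ?_
    filter_upwards [eventually_ge_atTop N] with n hn
    rw [approxState_segmentProj hv.family he he1 p σ ω (by omega), (hmem n).2]
  · exact (tendsto_approxState hv.family he he1 hp hphase σ hωs.2 hω μ ν).comp
      (tendsto_add_atTop_nat 1)

end Extension

/-! ### States supported on the projections of the sequence. -/

section Compression

variable {ι A : Type u} [CStarAlgebra A] {v : ι → A}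

lemma star_segmentProj (e : ℕ → A) (N : ℕ) : star (segmentProj e N) = segmentProj e N := by
  rw [segmentProj, star_mul, star_star]

lemma gauge_fiber (hv : IsToeplitzCuntz v) (z : Circle) {x : A} (hx : x ∈ fiber v) :
    hv.gauge z x = (z : ℂ) • x := by
  have hcont : Continuous (hv.gauge z) := AddMonoidHomClass.continuous_of_bound _ 1 fun a => by
    simpa using NonUnitalStarAlgHom.norm_apply_le (hv.gauge z) a
  refine fiber_induction (P := fun x => hv.gauge z x = (z : ℂ) • x) ?_ (by simp) ?_ ?_
    (hv.gauge_apply z) hx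
  · exact isClosed_eq hcont (by fun_prop)
  · intro a b ha hb; rw [map_add, ha, hb, smul_add]
  · intro c a ha; rw [map_smul, ha, smul_comm]

lemma segmentProj_mem (hv : IsToeplitzCuntz v) {e : ℕ → A} (he : ∀ k, e k ∈ fiber v) (N : ℕ) :
    segmentProj e N ∈ hv.fixedPointAlgebra := by
  intro z
  have h : hv.gauge z (segment e 0 N) = (z : ℂ) ^ N • segment e 0 N := by
    induction N with
    | zero => simp [segment]
    | succ n ih => rw [segment, map_mul, ih, gauge_fiber hv z (he _), smul_mul_smul_comm, pow_succ]
  have hz : (z : ℂ) * star (z : ℂ) = 1 := by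
    simp [Complex.mul_conj', Circle.norm_coe]
  rw [segmentProj, map_mul, map_star, h, star_smul, smul_mul_smul_comm, star_pow,
    ← mul_pow, hz, one_pow, one_smul]

variable [Nontrivial A] (hv : IsIsometryFamily v) {e : ℕ → A} (he : ∀ k, e k ∈ fiber v)
  (he1 : ∀ k, ‖e k‖ = 1)
include hv he

lemma segmentProj_mul_word_mul (k l : ℕ) (μ : Fin k → ι) (ν : Fin l → ι) :
    segmentProj e k * (word v μ * star (word v ν)) * segmentProj e l =
      ((∏ a : Fin k, ip (v (μ a)) (e a)) * ∏ b : Fin l, ip (e b) (v (ν b))) •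
        (segment e 0 k * star (segment e 0 l)) := by
  have : segmentProj e k * (word v μ * star (word v ν)) * segmentProj e l =
      segment e 0 k * ((star (segment e 0 k) * word v μ) *
        (star (word v ν) * segment e 0 l)) * star (segment e 0 l) := by
    simp only [segmentProj, mul_assoc]
  rw [this, star_segment_mul_word hv he, star_word_mul_segment hv he, smul_mul_smul_comm, one_mul,
    mul_smul_comm, mul_one, smul_mul_assoc]

include he1

lemma segmentProj_mul_self (N : ℕ) : segmentProj e N * segmentProj e N = segmentProj e N := by
  have h := segmentProj_mul_segment hv he he1 N 0
  rw [add_zero] at h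
  nth_rw 2 [segmentProj]
  rw [← mul_assoc, h, segmentProj]

lemma segmentProj_add_mul (k l i : ℕ) :
    segmentProj e (k + i) * (segment e 0 k * star (segment e 0 l)) * segmentProj e (l + i) =
      (∏ j ∈ Finset.range i, ip (e (l + j)) (e (k + j))) •
        (segment e 0 (k + i) * star (segment e 0 (l + i))) := by
  have h : ∀ k, star (segment e 0 (k + i)) * segment e 0 k = star (segment e k i) := by
    intro k
    rw [segment_add, star_mul, mul_assoc, star_segment_mul_self hv he he1, mul_one, zero_add]
  have h' : star (segment e 0 l) * segment e 0 (l + i) = segment e l i := by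
    rw [← star_star (segment e l i), ← h l, star_mul, star_star]
  have : segmentProj e (k + i) * (segment e 0 k * star (segment e 0 l)) * segmentProj e (l + i) =
      segment e 0 (k + i) * ((star (segment e 0 (k + i)) * segment e 0 k) *
        (star (segment e 0 l) * segment e 0 (l + i))) * star (segment e 0 (l + i)) := by
    simp only [segmentProj, mul_assoc]
  rw [this, h, h', star_segment_mul_segment hv he, mul_smul_comm, mul_one, smul_mul_assoc]

variable {φ : StrongDual ℂ A} (hφ : φ ∈ stateSpace A) (hφP : ∀ N, φ (segmentProj e N) = 1)
include hφ hφP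

lemma state_compress (k l : ℕ) (a : A) :
    φ (segmentProj e k * a * segmentProj e l) = φ a := by
  rw [stateSpace_mul_right hφ (star_segmentProj e l) (segmentProj_mul_self hv he he1 l) (hφP l),
    stateSpace_mul_left hφ (star_segmentProj e k) (segmentProj_mul_self hv he he1 k) (hφP k)]

lemma state_word (k l : ℕ) (μ : Fin k → ι) (ν : Fin l → ι) :
    φ (word v μ * star (word v ν)) = φ (segment e 0 k * star (segment e 0 l)) *
      (∏ a : Fin k, ip (v (μ a)) (e a)) * ∏ b : Fin l, ip (e b) (v (ν b)) := by
  rw [← state_compress hv he he1 hφ hφP k l, segmentProj_mul_word_mul hv he, map_smul, smul_eq_mul]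
  ring

/-- Compression by `P_{k+i}` and `P_{l+i}` extends both segments by `i` vectors at the cost of a
scalar. This recursion governs all values of an extension. -/
lemma state_segment (k l i : ℕ) :
    φ (segment e 0 k * star (segment e 0 l)) =
      (∏ j ∈ Finset.range i, ip (e (l + j)) (e (k + j))) *
        φ (segment e 0 (k + i) * star (segment e 0 (l + i))) := by
  rw [← state_compress hv he he1 hφ hφP (k + i) (l + i), segmentProj_add_mul hv he he1, map_smul,
    smul_eq_mul]

omit hφP in
lemma norm_state_segment_le (k l : ℕ) : ‖φ (segment e 0 k * star (segment e 0 l))‖ ≤ 1 := by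
  refine (stateSpace_norm_apply_le hφ _).trans ((norm_mul_le _ _).trans ?_)
  rw [norm_star]
  exact mul_le_one₀ (norm_segment_le hv he he1 _ _) (norm_nonneg _) (norm_segment_le hv he he1 _ _)

lemma state_segment_eq_zero {p : ℕ} (hp : HasPeriod e p) {k l : ℕ}
    (h : ¬ (p : ℤ) ∣ (k : ℤ) - l) : φ (segment e 0 k * star (segment e 0 l)) = 0 := by
  have h0 := (tendsto_prod_ip_zero hv he he1 hp h).norm
  rw [norm_zero] at h0
  rw [← norm_le_zero_iff]
  refine ge_of_tendsto h0 (Eventually.of_forall fun i => ?_)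
  rw [state_segment hv he he1 hφ hφP k l i, norm_mul]
  exact mul_le_of_le_one_right (norm_nonneg _) (norm_state_segment_le hv he he1 hφ _ _)

/-- By `state_segment`, later values differ from the `N`-th one by a factor close to 1, and all
values are bounded by 1, so they form a Cauchy sequence. -/
lemma exists_tendsto_state_segment {p : ℕ} (hp : HasPeriod e p)
    (hphase : ∀ i, 0 ≤ ip (e i) (e (i + p))) {k l : ℕ} (h : (p : ℤ) ∣ (k : ℤ) - l) :
    ∃ c, Tendsto (fun n => φ (segment e 0 (k + n) * star (segment e 0 (l + n)))) atTop (𝓝 c) := by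
  refine cauchySeq_tendsto_of_complete (Metric.cauchySeq_iff'.2 fun ε hε => ?_)
  obtain ⟨N, hN⟩ := exists_norm_prod_ip_sub_one_le hv he he1 hp hphase h (half_pos hε)
  refine ⟨N, fun n hn => ?_⟩
  obtain ⟨i, rfl⟩ := Nat.exists_eq_add_of_le hn
  rw [state_segment hv he he1 hφ hφP (k + N) (l + N) i, dist_comm, dist_eq_norm, ← add_assoc,
    ← add_assoc, ← sub_one_mul, norm_mul]
  have h1 := norm_state_segment_le hv he he1 hφ (k + N + i) (l + N + i)
  calc _ ≤ ε / 2 * 1 := mul_le_mul (hN N le_rfl i) h1 (norm_nonneg _) (half_pos hε).le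
    _ < ε := by linarith

/-- A state supported on the projections of `e` has the asserted form on words. -/
theorem exists_measure_of_state {p : ℕ} (hp : HasPeriod e p)
    (hphase : ∀ i, 0 ≤ ip (e i) (e (i + p))) :
    ∃ σ : ProbabilityMeasure Circle, ∀ (k l : ℕ) (μ : Fin k → ι) (ν : Fin l → ι),
      φ (word v μ * star (word v ν)) =
        coeff e p σ k l * (∏ a : Fin k, ip (v (μ a)) (e a)) * ∏ b : Fin l, ip (e b) (v (ν b)) := by
  have hp' : (p : ℤ) ≠ 0 := by have := hp.1.1; omega
  have hdiff : ∀ m : ℤ, (m.toNat : ℤ) - ((-m).toNat : ℤ) = m := fun m => by omega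
  have hex : ∀ m : ℤ, ∃ c, Tendsto (fun n => φ (segment e 0 (m.toNat * p + n) *
      star (segment e 0 ((-m).toNat * p + n)))) atTop (𝓝 c) := fun m =>
    exists_tendsto_state_segment hv he he1 hφ hφP hp hphase
      ⟨m, by push_cast; rw [← sub_mul, hdiff, mul_comm]⟩
  choose c hc using hex
  -- Any pair with difference `p m` is a shift of the minimal pair that defines `c m`, so the limit
  -- is the same.
  have hlim : ∀ (m : ℤ) (k l : ℕ), (k : ℤ) - l = p * m →
      Tendsto (fun n => φ (segment e 0 (k + n) * star (segment e 0 (l + n)))) atTop (𝓝 (c m)) := by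
    intro m k l hkl
    obtain ⟨d, hk, hl⟩ : ∃ d, k = m.toNat * p + d ∧ l = (-m).toNat * p + d := by
      rcases le_total 0 m with hm | hm
      · obtain ⟨a, rfl⟩ := Int.eq_ofNat_of_zero_le hm
        refine ⟨l, ?_, by simp⟩
        zify
        simp only [Int.toNat_natCast]
        linarith
      · obtain ⟨a, ha⟩ := Int.eq_ofNat_of_zero_le (neg_nonneg.2 hm)
        obtain rfl : m = -(a : ℤ) := by rw [← ha, neg_neg]
        refine ⟨k, by simp, ?_⟩
        zify
        simp only [neg_neg, Int.toNat_natCast]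
        linarith
    refine ((hc m).comp (tendsto_add_atTop_nat d)).congr fun n => ?_
    rw [Function.comp, hk, hl, add_comm n d, add_assoc, add_assoc]
  have hc0 : c 0 = 1 := by
    refine tendsto_nhds_unique (hlim 0 0 0 (by simp)) (tendsto_const_nhds.congr fun n => ?_)
    exact (hφP (0 + n)).symm
  have hpos : ∀ (n : ℕ) (a : ℕ → ℂ), 0 ≤ ∑ j ∈ Finset.range n, ∑ i ∈ Finset.range n,
      (starRingEnd ℂ) (a j) * a i * c ((i : ℤ) - j) := by
    intro n a
    have ht : Tendsto (fun N => ∑ j ∈ Finset.range n, ∑ i ∈ Finset.range n,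
        (starRingEnd ℂ) (a j) * a i *
          φ (segment e 0 (i * p + N) * star (segment e 0 (j * p + N)))) atTop
        (𝓝 (∑ j ∈ Finset.range n, ∑ i ∈ Finset.range n,
          (starRingEnd ℂ) (a j) * a i * c ((i : ℤ) - j))) :=
      tendsto_finsetSum _ fun j _ => tendsto_finsetSum _ fun i _ =>
        (hlim ((i : ℤ) - j) _ _ (by push_cast; ring)).const_mul _
    refine ge_of_tendsto ht (Eventually.of_forall fun N => ?_)
    -- Before the limit, the quadratic form is `φ(y y⋆)` with `y = ∑ a_i E_{ip+N}`.
    refine (hφ.1 (star (∑ i ∈ Finset.range n, a i • segment e 0 (i * p + N)))).trans_eq ?_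
    rw [star_star, star_sum, Finset.mul_sum, map_sum]
    refine Finset.sum_congr rfl fun j _ => ?_
    rw [Finset.sum_mul, map_sum]
    refine Finset.sum_congr rfl fun i _ => ?_
    rw [star_smul, smul_mul_smul_comm, map_smul, smul_eq_mul, mul_comm (a i)]
    rfl
  obtain ⟨σ, hσ⟩ := exists_fourierCoeff_eq c hc0 hpos
  refine ⟨σ, fun k l μ ν => ?_⟩
  rw [state_word hv he he1 hφ hφP]
  congr 2
  by_cases hd : (p : ℤ) ∣ (k : ℤ) - l
  · rw [coeff, if_pos hd]
    obtain ⟨m, hm⟩ := hd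
    rw [hm, Int.mul_ediv_cancel_left _ hp', hσ, mul_comm]
    refine tendsto_nhds_unique tendsto_const_nhds
      (((tendsto_prod_ip hv he he1 hp hphase ⟨m, hm⟩).mul (hlim m k l hm)).congr fun i => ?_)
    exact (state_segment hv he he1 hφ hφP k l i).symm
  · rw [coeff, if_neg hd, state_segment_eq_zero hv he he1 hφ hφP hp hd]

omit hφ hφP

/-- The coefficients on words determine the measure. -/
theorem measure_eq_of_coeff {p : ℕ} (hp : HasPeriod e p)
    (hphase : ∀ i, 0 ≤ ip (e i) (e (i + p))) {σ τ : ProbabilityMeasure Circle}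
    (h : ∀ (k l : ℕ) (μ : Fin k → ι) (ν : Fin l → ι),
      coeff e p σ k l * (∏ a : Fin k, ip (v (μ a)) (e a)) * ∏ b : Fin l, ip (e b) (v (ν b)) =
      coeff e p τ k l * (∏ a : Fin k, ip (v (μ a)) (e a)) * ∏ b : Fin l, ip (e b) (v (ν b))) :
    σ = τ := by
  have hp' : (p : ℤ) ≠ 0 := by have := hp.1.1; omega
  -- A unit vector in the closed span is not orthogonal to every generator; these indices give words
  -- with nonzero scalar factors.
  have hex : ∀ a, ∃ i, ip (v i) (e a) ≠ 0 := by
    intro a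
    by_contra! hall
    have h0 : star (e a) * e a = 0 := by
      refine fiber_induction (P := fun x => star (e a) * x = 0) ?_ (by simp) ?_ ?_ ?_ (he a)
      · exact isClosed_eq (by fun_prop) continuous_const
      · intro x y hx hy; rw [mul_add, hx, hy, add_zero]
      · intro c x hx; rw [mul_smul_comm, hx, smul_zero]
      · intro i; rw [star_mul_eq_ip hv (mem_fiber i) (he a), hall i, zero_smul]
    rw [CStarRing.star_mul_self_eq_zero_iff] at h0
    simpa [h0] using he1 a
  choose f hf using hex
  refine fourierCoeff_injective fun m => ?_
  have hdvd : ∀ n : ℕ, ((m.toNat * p + n : ℕ) : ℤ) - ((-m).toNat * p + n : ℕ) = p * m := by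
    intro n
    have : (m.toNat : ℤ) - ((-m).toNat : ℤ) = m := by omega
    push_cast
    rw [add_sub_add_right_eq_sub, ← sub_mul, this, mul_comm]
  -- The infinite product may vanish for small `k`, `l`. Shifting both by `N` keeps the partial
  -- products within 1/2 of 1, hence their limit nonzero.
  obtain ⟨N, hN⟩ := exists_norm_prod_ip_sub_one_le hv he he1 hp hphase
    (k := m.toNat * p) (l := (-m).toNat * p) ⟨m, by simpa using hdvd 0⟩ one_half_pos
  have hlim := ((tendsto_prod_ip hv he he1 hp hphase ⟨m, hdvd N⟩).sub_const 1).norm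
  have hT : ∏' i, ip (e ((-m).toNat * p + N + i)) (e (m.toNat * p + N + i)) ≠ 0 := by
    intro h0
    rw [h0] at hlim
    have := le_of_tendsto hlim (Eventually.of_forall fun i => hN N le_rfl i)
    norm_num at this
  have h1 := h (m.toNat * p + N) ((-m).toNat * p + N) (fun a => f a) (fun a => f a)
  have hC : ∀ k : ℕ, ∏ a : Fin k, ip (v (f a)) (e a) ≠ 0 := fun k =>
    Finset.prod_ne_zero_iff.2 fun a _ => hf a
  have hC' : ∀ k : ℕ, ∏ a : Fin k, ip (e a) (v (f a)) ≠ 0 := fun k =>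
    Finset.prod_ne_zero_iff.2 fun a _ => by
      rw [← ip_conj hv (mem_fiber _) (he _)]
      exact (map_ne_zero _).2 (hf a)
  have h2 := mul_right_cancel₀ (hC _) (mul_right_cancel₀ (hC' _) h1)
  rw [coeff, coeff, if_pos ⟨m, hdvd N⟩, if_pos ⟨m, hdvd N⟩, hdvd N,
    Int.mul_ediv_cancel_left _ hp'] at h2
  exact mul_right_cancel₀ hT h2

end Compression

/-! ### Uniqueness and purity of the product state; the main theorem. -/

section Main

variable {ι A : Type u} [CStarAlgebra A] {v : ι → A}

lemma coeff_affine (e : ℕ → A) (p : ℕ) {σ₁ σ₂ σ : ProbabilityMeasure Circle} {t : ℝ} (h0 : 0 ≤ t)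
    (h1 : t ≤ 1) (h : (σ : Measure Circle) = ENNReal.ofReal t • (σ₁ : Measure Circle) +
      ENNReal.ofReal (1 - t) • (σ₂ : Measure Circle)) (k l : ℕ) :
    coeff e p σ k l = t * coeff e p σ₁ k l + (1 - t) * coeff e p σ₂ k l := by
  have hF : ∀ m, fourierCoeff σ m = t * fourierCoeff σ₁ m + (1 - t) * fourierCoeff σ₂ m := by
    intro m
    have hint : ∀ τ : ProbabilityMeasure Circle,
        Integrable (fun z : Circle => (z : ℂ) ^ (-m)) (τ : Measure Circle) := fun τ =>
      (circleMonomial (-m)).integrable _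
    change ∫ z : Circle, (z : ℂ) ^ (-m) ∂(σ : Measure Circle) = _
    rw [h, integral_add_measure ((hint _).smul_measure ENNReal.ofReal_ne_top)
      ((hint _).smul_measure ENNReal.ofReal_ne_top), integral_smul_measure, integral_smul_measure,
      ENNReal.toReal_ofReal h0, ENNReal.toReal_ofReal (sub_nonneg.2 h1), Complex.real_smul,
      Complex.real_smul]
    push_cast
    rfl
  unfold coeff
  split_ifs
  · rw [hF]; ring
  · simp

/-- The restriction of a functional to the fixed point algebra. -/
noncomputable def IsToeplitzCuntz.restrict (hv : IsToeplitzCuntz v) (φ : StrongDual ℂ A) :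
    StrongDual ℂ hv.fixedPointAlgebra where
  toFun a := φ a
  map_add' a b := map_add φ (a : A) b
  map_smul' c a := map_smul φ c (a : A)
  cont := φ.continuous.comp continuous_subtype_val

lemma IsToeplitzCuntz.restrict_mem (hv : IsToeplitzCuntz v) {φ : StrongDual ℂ A}
    (hφ : φ ∈ stateSpace A) : hv.restrict φ ∈ stateSpace hv.fixedPointAlgebra :=
  ⟨fun a => hφ.1 (a : A), hφ.2⟩

lemma IsToeplitzCuntz.IsProductState.unique {hv : IsToeplitzCuntz v} {e : ℕ → A}
    {ρ ρ' : StrongDual ℂ hv.fixedPointAlgebra} (h : hv.IsProductState e ρ)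
    (h' : hv.IsProductState e ρ') : ρ = ρ' :=
  hv.fixedPoint_dual_ext fun m μ ν => by rw [h.2, h'.2]

/-- A state of the fixed point algebra supported on the projections of `e` is the product state. -/
lemma IsToeplitzCuntz.isProductState_of_segmentProj [Nontrivial A] (hv : IsToeplitzCuntz v)
    {e : ℕ → A} (he : ∀ k, e k ∈ fiber v) (he1 : ∀ k, ‖e k‖ = 1)
    {ρ : StrongDual ℂ hv.fixedPointAlgebra} (hρ : ρ ∈ stateSpace hv.fixedPointAlgebra)
    (h : ∀ N, ρ ⟨segmentProj e N, segmentProj_mem hv he N⟩ = 1) : hv.IsProductState e ρ := by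
  refine ⟨hρ, fun m μ ν => ?_⟩
  let q : hv.fixedPointAlgebra := ⟨segmentProj e m, segmentProj_mem hv he m⟩
  have hq : star q = q := Subtype.ext (star_segmentProj e m)
  have hqq : q * q = q := Subtype.ext (segmentProj_mul_self hv.family he he1 m)
  rw [← stateSpace_mul_left hρ hq hqq (h m), ← stateSpace_mul_right hρ hq hqq (h m)]
  have e1 : q * ⟨word v μ * star (word v ν), hv.word_mul_star_word_mem μ ν⟩ * q =
      ((∏ a : Fin m, ip (v (μ a)) (e a)) * ∏ b : Fin m, ip (e b) (v (ν b))) • q :=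
    Subtype.ext (segmentProj_mul_word_mul hv.family he m m μ ν)
  rw [e1, map_smul, h m, smul_eq_mul, mul_one]

/-- The product state is pure. -/
lemma IsToeplitzCuntz.IsProductState.mem_extremePoints [Nontrivial A] {hv : IsToeplitzCuntz v}
    {e : ℕ → A} (he : ∀ k, e k ∈ fiber v) (he1 : ∀ k, ‖e k‖ = 1)
    {ρ : StrongDual ℂ hv.fixedPointAlgebra} (hρ : hv.IsProductState e ρ)
    (h : ∀ N, ρ ⟨segmentProj e N, segmentProj_mem hv he N⟩ = 1) :
    ρ ∈ (stateSpace hv.fixedPointAlgebra).extremePoints ℝ := by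
  rw [mem_extremePoints_iff_left]
  refine ⟨hρ.1, fun ρ₁ h1 ρ₂ h2 hseg => ?_⟩
  refine (hv.isProductState_of_segmentProj he he1 h1 fun N => ?_).unique hρ
  obtain ⟨a, b, ha, hb, hab, hc⟩ := hseg
  let q : hv.fixedPointAlgebra := ⟨segmentProj e N, segmentProj_mem hv he N⟩
  have hq : star q = q := Subtype.ext (star_segmentProj e N)
  have hqq : q * q = q := Subtype.ext (segmentProj_mul_self hv.family he he1 N)
  -- Both states are at most 1 on `q` while a proper convex combination of them equals 1, so both
  -- equal 1.
  have hle : ∀ φ ∈ stateSpace hv.fixedPointAlgebra, 0 ≤ 1 - φ q := by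
    intro φ hφ
    have := hφ.1 (1 - q)
    have e1 : star (1 - q) * (1 - q) = 1 - q := by simp [hq, sub_mul, mul_sub, hqq]
    rwa [e1, map_sub, hφ.2] at this
  have p1 := Complex.nonneg_iff.1 (hle ρ₁ h1)
  have p2 := Complex.nonneg_iff.1 (hle ρ₂ h2)
  have hsum : (a : ℂ) * ρ₁ q + b * ρ₂ q = 1 := by
    rw [← h N, ← hc]
    simp [q]
  have hre := congrArg Complex.re hsum
  simp only [Complex.add_re, Complex.re_ofReal_mul, Complex.one_re] at hre
  simp only [Complex.sub_re, Complex.one_re, Complex.sub_im, Complex.one_im] at p1 p2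
  change ρ₁ q = 1
  refine Complex.ext ?_ ?_
  · rw [Complex.one_re]
    nlinarith
  · rw [Complex.one_im]
    linarith

end Main

end ToeplitzCuntz

theorem mainTheorem5 {ι A : Type u} [Countable ι] [CStarAlgebra A] (v : ι → A)
    (hv : ToeplitzCuntz.IsToeplitzCuntz v)
    (e : ℕ → A) (he : ∀ k, e k ∈ ToeplitzCuntz.fiber v) (he_unit : ∀ k, ‖e k‖ = 1)
    (p : ℕ) (hp : ToeplitzCuntz.HasPeriod e p)
    (hphase : ∀ i, 0 ≤ ToeplitzCuntz.ip (e i) (e (i + p))) :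
    (∃! ρ, hv.IsProductState e ρ) ∧
    (∀ k l : ℕ, (p : ℤ) ∣ (k : ℤ) - l →
      Multipliable fun i => ToeplitzCuntz.ip (e (l + i)) (e (k + i))) ∧
    ∀ ρ, hv.IsProductState e ρ →
      ρ ∈ (ToeplitzCuntz.stateSpace hv.fixedPointAlgebra).extremePoints ℝ ∧
      ∃ Ψ : ProbabilityMeasure Circle → StrongDual ℂ A,
        (∀ (σ : ProbabilityMeasure Circle) (k l : ℕ) (μ : Fin k → ι) (ν : Fin l → ι),
          Ψ σ (ToeplitzCuntz.word v μ * star (ToeplitzCuntz.word v ν)) =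
            ToeplitzCuntz.coeff e p σ k l *
              (∏ a : Fin k, ToeplitzCuntz.ip (v (μ a)) (e a)) *
              ∏ b : Fin l, ToeplitzCuntz.ip (e b) (v (ν b))) ∧
        Set.BijOn Ψ Set.univ (hv.stateExtensions ρ) ∧
        ∀ (σ₁ σ₂ σ : ProbabilityMeasure Circle) (t : ℝ), 0 ≤ t → t ≤ 1 →
          (σ : Measure Circle) =
            ENNReal.ofReal t • (σ₁ : Measure Circle) +
              ENNReal.ofReal (1 - t) • (σ₂ : Measure Circle) →
          Ψ σ = t • Ψ σ₁ + (1 - t) • Ψ σ₂ := by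
  have hnt : Nontrivial A := by
    refine ⟨⟨e 0, 0, fun h => ?_⟩⟩
    have := he_unit 0
    rw [h, norm_zero] at this
    exact zero_ne_one this
  have hf := hv.family
  choose Ψ hΨs hΨP hΨw using
    ToeplitzCuntz.IsToeplitzCuntz.exists_extension hv he he_unit hp hphase
  have hprod : ∀ σ, hv.IsProductState e (hv.restrict (Ψ σ)) := fun σ =>
    hv.isProductState_of_segmentProj he he_unit (hv.restrict_mem (hΨs σ)) (hΨP σ)
  have hrest : ∀ ρ, hv.IsProductState e ρ → ∀ σ, hv.restrict (Ψ σ) = ρ := fun ρ hρ σ =>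
    (hprod σ).unique hρ
  let σ₀ : ProbabilityMeasure Circle := ⟨Measure.dirac 1, inferInstance⟩
  refine ⟨⟨_, hprod σ₀, fun ρ hρ => hρ.unique (hprod σ₀)⟩,
    fun k l h => ToeplitzCuntz.multipliable_ip hf he he_unit hp hphase h, fun ρ hρ => ?_⟩
  -- By uniqueness `ρ` is the restriction of a constructed extension, which already takes the value
  -- 1 on `P_N`; no expansion of `P_N` in words is needed. Any measure serves as `σ₀`.
  have hρP : ∀ N, ρ ⟨ToeplitzCuntz.segmentProj e N, ToeplitzCuntz.segmentProj_mem hv he N⟩ = 1 :=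
    fun N => by
      rw [← hrest ρ hρ σ₀]
      exact hΨP σ₀ N
  refine ⟨hρ.mem_extremePoints he he_unit hρP, Ψ, hΨw, ⟨?_, ?_, ?_⟩, ?_⟩
  · intro σ _
    refine ⟨hΨs σ, fun a => ?_⟩
    rw [← hrest ρ hρ σ]
    rfl
  · intro σ _ τ _ h
    refine ToeplitzCuntz.measure_eq_of_coeff hf he he_unit hp hphase fun k l μ ν => ?_
    rw [← hΨw, ← hΨw, h]
  · rintro φ ⟨hφ, hφρ⟩
    have hφP : ∀ N, φ (ToeplitzCuntz.segmentProj e N) = 1 := fun N =>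
      (hφρ ⟨_, ToeplitzCuntz.segmentProj_mem hv he N⟩).trans (hρP N)
    obtain ⟨σ, hσ⟩ :=
      ToeplitzCuntz.exists_measure_of_state hf he he_unit hφ hφP hp hphase
    exact ⟨σ, trivial, hv.dual_ext fun k l μ ν => by rw [hΨw, hσ]⟩
  · intro σ₁ σ₂ σ t h0 h1 h
    refine hv.dual_ext fun k l μ ν => ?_
    have e1 : (t • Ψ σ₁ + (1 - t) • Ψ σ₂)
        (ToeplitzCuntz.word v μ * star (ToeplitzCuntz.word v ν)) =
        t * Ψ σ₁ (ToeplitzCuntz.word v μ * star (ToeplitzCuntz.word v ν)) +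
        (1 - t) * Ψ σ₂ (ToeplitzCuntz.word v μ * star (ToeplitzCuntz.word v ν)) := by
      simp [sub_mul]
    rw [e1, hΨw, hΨw, hΨw, ToeplitzCuntz.coeff_affine e p h0 h1 h]
    ring
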